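/- **Setting.** Let $d\ge 1$, $\gamma>1$, $c_v=\frac1{\gamma-1}$, $0<T<\infty$, and let $\Omega\subset\mathbb R^d$ be a bounded Lipschitz domain. For $\varrho\in\mathbb R$, $\mathbf m\in\mathbb R^d$, $S\in\mathbb R$ the total energy is $$E(\varrho,\mathbf m,S)=\begin{cases}\frac12\frac{|\mathbf m|^2}{\varrho}+\varrho^\gamma\exp\!\big(\frac{S}{c_v\varrho}\big)&\text{if }\varrho>0,\\ 0&\text{if }\varrho=0,\ \mathbf m=0,\ S\le 0,\\ \infty&\text{otherwise,}\end{cases}$$ and the pressure is $p(\varrho,S)=(\gamma-1)\varrho^\gamma\exp\!\big(\frac{S}{c_v\varrho}\big)$, with $p=0$ for $\varrho=0$. The initial data are measurable functions $\varrho_0,\mathbf m_0,S_0$ on $\Omega$ such that, for some $\underline s\in\mathbb R$, $$\varrho_0>0,\qquad S_0\ge\varrho_0\,\underline s\quad\text{a.e. in }\Omega,\qquad \int_\Omega E(\varrho_0,\mathbf m_0,S_0)\,dx<\infty .$$ **Stable approximation.** A sequence of measurable functions $(\varrho_n,\mathbf m_n,S_n)$ on $(0,T)\times\Omega$ is a stable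 approximation of the complete Euler system with these initial data if $\varrho_n\ge0$ a.e. and there are $M,\underline S\in\mathbb R$ (independent of $n$) and $e_n\to0$ such that for every $n$ and a.e. $\tau\in(0,T)$ the functions $\varrho_n(\tau,\cdot)$, $S_n(\tau,\cdot)$ are integrable on $\Omega$ and $$\int_\Omega\varrho_n(\tau,\cdot)\,dx\le M,\qquad \int_\Omega S_n(\tau,\cdot)\,dx\ge\underline S,\qquad \int_\Omega E(\varrho_n,\mathbf m_n,S_n)(\tau,\cdot)\,dx\le\int_\Omega E(\varrho_0,\mathbf m_0,S_0)\,dx+e_n .$$ **Biting limit.** On a finite measure space $Q$, an integrable function $f$ is the biting limit of a sequence of integrable functions $f_n$ if there are measurable sets $B_1\supseteq B_2\supseteq\dots$ with $|B_k|\to0$ such that $f_n\to f$ weakly in $L^1(Q\setminus B_k)$ for each fixed $k$. Here $Q=(0,T)\times\Omega$. **Admissible weak solution.** $[\varrho,\mathbf m,S]$ is an admissible weak solution of the complete Euler system in $(0,T)\times\Omega$ with initial data $[\varrho_0,\mathbf m_0,S_0]$ if $\varrho\ge0$ a.e., $S=0$ a.e. on $\{\varrho=0\}$, all quantities under the integrals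 below are integrable on $(0,\tau)\times\Omega$ and, at each time at which they are evaluated, on $\Omega$, and, with $[\cdot]_{t=0}^{t=\tau}$ denoting the value at $\tau$ minus the value at $0$ computed from the initial data, $$\Big[\int_\Omega\varrho\varphi\,dx\Big]_{t=0}^{t=\tau}=\int_0^\tau\!\!\int_\Omega\big(\varrho\,\partial_t\varphi+\mathbf m\cdot\nabla_x\varphi\big)dx\,dt,$$ $$\Big[\int_\Omega\mathbf m\cdot\boldsymbol\varphi\,dx\Big]_{t=0}^{t=\tau}=\int_0^\tau\!\!\int_\Omega\Big(\mathbf m\cdot\partial_t\boldsymbol\varphi+1_{\varrho>0}\frac{\mathbf m\otimes\mathbf m}{\varrho}:\nabla_x\boldsymbol\varphi+p(\varrho,S)\,\mathrm{div}_x\boldsymbol\varphi\Big)dx\,dt,$$ $$\Big[\int_\Omega E(\varrho,\mathbf m,S)\varphi\,dx\Big]_{t=0}^{t=\tau}=\int_0^\tau\!\!\int_\Omega\Big(E(\varrho,\mathbf m,S)\,\partial_t\varphi+1_{\varrho>0}\big(E(\varrho,\mathbf m,S)+p(\varrho,S)\big)\frac{\mathbf m}{\varrho}\cdot\nabla_x\varphi\Big)dx\,dt$$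 for all $0\le\tau<T$, all $\varphi\in C^1_c([0,T)\times\overline\Omega)$ and all $\boldsymbol\varphi\in C^1_c([0,T)\times\overline\Omega;\mathbb R^d)$ with $\boldsymbol\varphi\cdot\mathbf n|_{\partial\Omega}=0$, and $$\Big[\int_\Omega\varrho Z\big(\tfrac S\varrho\big)\varphi\,dx\Big]_{t=0}^{t=\tau}\ge\int_0^\tau\!\!\int_\Omega\Big(\varrho Z\big(\tfrac S\varrho\big)\partial_t\varphi+Z\big(\tfrac S\varrho\big)\mathbf m\cdot\nabla_x\varphi\Big)dx\,dt$$ for all $\varphi\in C^1_c([0,T)\times\overline\Omega)$ with $\varphi\ge0$, all bounded $Z\in C^1(\mathbb R)$ with $Z'\ge0$, and a.e. $0\le\tau<T$. A triple of a.e. equivalence classes is called an admissible weak solution if it has a representative with these properties. **Theorem.** Let $(\varrho_n,\mathbf m_n,S_n)_n$ be a stable approximation of the complete Euler system with initial data $[\varrho_0,\mathbf m_0,S_0]$ as above. Then there is a constant $c$ such that for all $n$ $$\operatorname*{ess\,sup}_{\tau\in(0,T)}\Big[\|\varrho_n(\tau,\cdot)\|_{L^1(\Omega)}+\|\mathbf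 m_n(\tau,\cdot)\|_{L^1(\Omega;\mathbb R^d)}+\|S_n(\tau,\cdot)\|_{L^1(\Omega)}\Big]\le c,$$ and there is a subsequence (not relabelled) which has a biting limit $$[\varrho,\mathbf m,S]\in L^\infty(0,T;L^1(\Omega;\mathbb R^{d+2}))$$ such that, if $[\varrho,\mathbf m,S]$ is an admissible weak solution of the complete Euler system with initial data $[\varrho_0,\mathbf m_0,S_0]$, then $$\varrho_n\to\varrho,\qquad \mathbf m_n\to\mathbf m,\qquad S_n\to S\qquad\text{a.e. in }(0,T)\times\Omega .$$ -/

import Mathlib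

open MeasureTheory Set Filter Topology
open scoped ENNReal NNReal

/-- The physical space `ℝ^d` with its Euclidean norm. -/
abbrev Space (d : ℕ) : Type := EuclideanSpace ℝ (Fin d)

/-! ### Geometry of the domain -/

/-- Near every boundary point, `Ω` is the strict epigraph of a Lipschitz function of the variables
orthogonal to some unit direction `e`. -/
def HasLipschitzBoundary {d : ℕ} (Ω : Set (Space d)) : Prop :=
  ∀ x₀ ∈ frontier Ω, ∃ (e : Space d) (h : Space d → ℝ) (L : ℝ≥0) (r : ℝ),
    ‖e‖ = 1 ∧ LipschitzWith L h ∧ 0 < r ∧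
      ∀ y ∈ Metric.ball x₀ r, (y ∈ Ω ↔ h (y - inner ℝ e y • e) < inner ℝ e y)

/-- A bounded Lipschitz domain: nonempty, open, connected, bounded, with Lipschitz boundary. -/
structure IsBoundedLipschitzDomain {d : ℕ} (Ω : Set (Space d)) : Prop where
  isOpen : IsOpen Ω
  isConnected : IsConnected Ω
  isBounded : Bornology.IsBounded Ω
  lipschitz : HasLipschitzBoundary Ω

/-- `ν` is the outer unit normal to `Ω` at `x`: near `x` every open cone around `-ν` of opening less
than a half-space lies in `Ω`, and every such cone around `ν` lies outside `Ω`.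
If `∂Ω` is locally the graph of a Lipschitz function, such a `ν` exists exactly at the points where
that function is differentiable (hence at almost every boundary point), and it is the usual outer
normal there. -/
def IsOuterNormal {d : ℕ} (Ω : Set (Space d)) (x ν : Space d) : Prop :=
  ‖ν‖ = 1 ∧ ∀ ε > 0, ∃ δ > 0, ∀ y ∈ Metric.ball x δ,
    (inner ℝ (y - x) ν < -(ε * ‖y - x‖) → y ∈ Ω) ∧
    (ε * ‖y - x‖ < inner ℝ (y - x) ν → y ∉ Ω)

/-! ### Thermodynamics -/

/-- Specific heat at constant volume, `c_v = 1 / (γ - 1)`. -/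
noncomputable def heatCv (γ : ℝ) : ℝ := 1 / (γ - 1)

/-- Internal energy per unit volume `ϱ e = ϱ^γ exp (S / (c_v ϱ))`; it vanishes at `ϱ = 0`. -/
noncomputable def internalEnergy (γ ρ S : ℝ) : ℝ :=
  ρ ^ γ * Real.exp (S / (heatCv γ * ρ))

/-- The pressure `p = (γ - 1) ϱ e`. -/
noncomputable def pressure (γ ρ S : ℝ) : ℝ := (γ - 1) * internalEnergy γ ρ S

open Classical in
/-- The total energy as an extended-valued function of density, momentum and total entropy. -/
noncomputable def totalEnergy {d : ℕ} (γ ρ : ℝ) (m : Space d) (S : ℝ) : ℝ≥0∞ :=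
  if 0 < ρ then ENNReal.ofReal (‖m‖ ^ 2 / (2 * ρ) + internalEnergy γ ρ S)
  else if ρ = 0 ∧ m = 0 ∧ S ≤ 0 then 0
  else ⊤

/-! ### Function spaces on `(0,T) × Ω` -/

/-- Lebesgue measure on the space-time cylinder `(0,T) × Ω`. -/
noncomputable def cylinderMeasure {d : ℕ} (T : ℝ) (Ω : Set (Space d)) : Measure (ℝ × Space d) :=
  volume.restrict (Ioo 0 T ×ˢ Ω)

/-- `f ∈ L^∞(0,T; L^1(Ω; F))`. -/
def MemLinftyL1 {d : ℕ} {F : Type*} [NormedAddCommGroup F] (T : ℝ) (Ω : Set (Space d))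
    (f : ℝ → Space d → F) : Prop :=
  AEStronglyMeasurable (fun z : ℝ × Space d => f z.1 z.2) (cylinderMeasure T Ω) ∧
    ∃ C : ℝ≥0, ∀ᵐ τ ∂(volume.restrict (Ioo 0 T)), ∫⁻ x in Ω, ‖f τ x‖ₑ ≤ C

/-- Biting convergence: after removing sets `B k` that decrease to measure zero, the sequence `f`
converges to `g` weakly in `L^1` of the complement of each fixed `B k`. -/
def IsBitingLimit {X F : Type*} [MeasurableSpace X] [NormedAddCommGroup F] [NormedSpace ℝ F]
    (μ : Measure X) (f : ℕ → X → F) (g : X → F) : Prop :=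
  (∀ n, Integrable (f n) μ) ∧ Integrable g μ ∧
    ∃ B : ℕ → Set X, (∀ k, MeasurableSet (B k)) ∧ Antitone B ∧
      Tendsto (fun k => μ (B k)) atTop (𝓝 0) ∧
      ∀ k, ∀ w : X → ℝ, Measurable w → (∃ C : ℝ, ∀ x, |w x| ≤ C) →
        Tendsto (fun n => ∫ x in (B k)ᶜ, w x • f n x ∂μ) atTop
          (𝓝 (∫ x in (B k)ᶜ, w x • g x ∂μ))

/-! ### Test functions -/

/-- Test functions in `C^1_c([0,T) × closure Ω; F)`, given as restrictions of continuously
differentiable functions on space-time with compact support in `(-∞,T) × ℝ^d`. -/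
structure IsTestFunction {d : ℕ} {F : Type*} [NormedAddCommGroup F] [NormedSpace ℝ F] (T : ℝ)
    (φ : ℝ × Space d → F) : Prop where
  contDiff : ContDiff ℝ 1 φ
  hasCompactSupport : HasCompactSupport φ
  tsupport_subset : tsupport φ ⊆ Iio T ×ˢ univ

/-- The impermeability condition `φ · n = 0` on `[0,T) × ∂Ω`. (For continuous `φ` on a Lipschitz
domain, asking this at almost every boundary point or at every point that has a normal is the
same.) -/
def IsTangentialOn {d : ℕ} (T : ℝ) (Ω : Set (Space d)) (φ : ℝ × Space d → Space d) : Prop :=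
  ∀ t ∈ Ico 0 T, ∀ x ∈ frontier Ω, ∀ ν, IsOuterNormal Ω x ν → inner ℝ (φ (t, x)) ν = 0

/-- Partial derivative in time. -/
noncomputable def timeDeriv {d : ℕ} {F : Type*} [NormedAddCommGroup F] [NormedSpace ℝ F]
    (φ : ℝ × Space d → F) (t : ℝ) (x : Space d) : F :=
  deriv (fun s => φ (s, x)) t

/-- Derivative in space; for scalar `φ`, `spaceDeriv φ t x v` is `∇_x φ (t,x) · v`. -/
noncomputable def spaceDeriv {d : ℕ} {F : Type*} [NormedAddCommGroup F] [NormedSpace ℝ F]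
    (φ : ℝ × Space d → F) (t : ℝ) (x : Space d) : Space d →L[ℝ] F :=
  fderiv ℝ (fun y => φ (t, y)) x

/-- Divergence in space. -/
noncomputable def spaceDiv {d : ℕ} (φ : ℝ × Space d → Space d) (t : ℝ) (x : Space d) : ℝ :=
  ∑ i : Fin d, (spaceDeriv φ t x (EuclideanSpace.single i 1)) i

/-! ### Admissible weak solutions -/

/-- `[ρ, m, S]` is an admissible weak solution of the complete Euler system in `(0,T) × Ω` (with
`Ω` bounded) with initial data `[ρ₀, m₀, S₀]`. The fields up to `integrable_energyFlux` spell out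
that all quantities under the integrals are integrable up to every time `τ < T`. -/
structure IsAdmissibleWeakSolution {d : ℕ} (γ T : ℝ) (Ω : Set (Space d))
    (ρ₀ : Space d → ℝ) (m₀ : Space d → Space d) (S₀ : Space d → ℝ)
    (ρ : ℝ → Space d → ℝ) (m : ℝ → Space d → Space d) (S : ℝ → Space d → ℝ) : Prop where
  measurable_density :
    AEStronglyMeasurable (fun z : ℝ × Space d => ρ z.1 z.2) (cylinderMeasure T Ω)
  measurable_momentum :
    AEStronglyMeasurable (fun z : ℝ × Space d => m z.1 z.2) (cylinderMeasure T Ω)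
  measurable_entropy :
    AEStronglyMeasurable (fun z : ℝ × Space d => S z.1 z.2) (cylinderMeasure T Ω)
  integrable_initial : IntegrableOn ρ₀ Ω ∧ IntegrableOn m₀ Ω ∧
    AEMeasurable (fun x => totalEnergy γ (ρ₀ x) (m₀ x) (S₀ x)) (volume.restrict Ω) ∧
    ∫⁻ x in Ω, totalEnergy γ (ρ₀ x) (m₀ x) (S₀ x) ≠ ⊤
  integrable_slice : ∀ τ ∈ Ico 0 T, IntegrableOn (ρ τ) Ω ∧ IntegrableOn (m τ) Ω ∧
    AEMeasurable (fun x => totalEnergy γ (ρ τ x) (m τ x) (S τ x)) (volume.restrict Ω) ∧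
    ∫⁻ x in Ω, totalEnergy γ (ρ τ x) (m τ x) (S τ x) ≠ ⊤
  integrable_density : ∀ τ ∈ Ico 0 T,
    Integrable (fun z : ℝ × Space d => ρ z.1 z.2) (cylinderMeasure τ Ω)
  integrable_momentum : ∀ τ ∈ Ico 0 T,
    Integrable (fun z : ℝ × Space d => m z.1 z.2) (cylinderMeasure τ Ω)
  integrable_momentumFlux : ∀ τ ∈ Ico 0 T,
    Integrable (fun z : ℝ × Space d =>
      if 0 < ρ z.1 z.2 then ‖m z.1 z.2‖ ^ 2 / ρ z.1 z.2 else 0) (cylinderMeasure τ Ω)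
  integrable_pressure : ∀ τ ∈ Ico 0 T,
    Integrable (fun z : ℝ × Space d => pressure γ (ρ z.1 z.2) (S z.1 z.2)) (cylinderMeasure τ Ω)
  integrable_energy : ∀ τ ∈ Ico 0 T,
    ∫⁻ z, totalEnergy γ (ρ z.1 z.2) (m z.1 z.2) (S z.1 z.2) ∂(cylinderMeasure τ Ω) ≠ ⊤
  integrable_energyFlux : ∀ τ ∈ Ico 0 T,
    Integrable (fun z : ℝ × Space d =>
      if 0 < ρ z.1 z.2 then
        (((totalEnergy γ (ρ z.1 z.2) (m z.1 z.2) (S z.1 z.2)).toReal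
          + pressure γ (ρ z.1 z.2) (S z.1 z.2)) / ρ z.1 z.2) • m z.1 z.2
      else 0) (cylinderMeasure τ Ω)
  density_nonneg : ∀ᵐ z ∂(cylinderMeasure T Ω), 0 ≤ ρ z.1 z.2
  entropy_vacuum : ∀ᵐ z ∂(cylinderMeasure T Ω), ρ z.1 z.2 = 0 → S z.1 z.2 = 0
  /-- Balance of mass. At `τ = 0` this says that `ρ 0 = ρ₀` a.e.; similarly below. -/
  continuity_eq : ∀ φ : ℝ × Space d → ℝ, IsTestFunction T φ → ∀ τ ∈ Ico 0 T,
    (∫ x in Ω, ρ τ x * φ (τ, x)) - (∫ x in Ω, ρ₀ x * φ (0, x)) =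
      ∫ t in Ioo 0 τ, ∫ x in Ω,
        (ρ t x * timeDeriv φ t x + spaceDeriv φ t x (m t x))
  /-- Balance of momentum; `(m ⊗ m) : ∇_x φ = m · (∇_x φ) m`. -/
  momentum_eq : ∀ φ : ℝ × Space d → Space d, IsTestFunction T φ → IsTangentialOn T Ω φ →
    ∀ τ ∈ Ico 0 T,
    (∫ x in Ω, inner ℝ (m τ x) (φ (τ, x))) - (∫ x in Ω, inner ℝ (m₀ x) (φ (0, x))) =
      ∫ t in Ioo 0 τ, ∫ x in Ω,
        (inner ℝ (m t x) (timeDeriv φ t x)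
          + (if 0 < ρ t x then inner ℝ (m t x) (spaceDeriv φ t x (m t x)) / ρ t x else 0)
          + pressure γ (ρ t x) (S t x) * spaceDiv φ t x)
  /-- Balance of total energy. -/
  energy_eq : ∀ φ : ℝ × Space d → ℝ, IsTestFunction T φ → ∀ τ ∈ Ico 0 T,
    (∫ x in Ω, (totalEnergy γ (ρ τ x) (m τ x) (S τ x)).toReal * φ (τ, x))
      - (∫ x in Ω, (totalEnergy γ (ρ₀ x) (m₀ x) (S₀ x)).toReal * φ (0, x)) =
      ∫ t in Ioo 0 τ, ∫ x in Ω,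
        ((totalEnergy γ (ρ t x) (m t x) (S t x)).toReal * timeDeriv φ t x
          + (if 0 < ρ t x then
              ((totalEnergy γ (ρ t x) (m t x) (S t x)).toReal + pressure γ (ρ t x) (S t x))
                / ρ t x * spaceDeriv φ t x (m t x)
            else 0))
  /-- Renormalized entropy inequality. (Finiteness of the energy forces `m = 0` a.e. on the set
  `ρ = 0`, so the value of the quotient there is irrelevant.) -/
  entropy_ineq : ∀ φ : ℝ × Space d → ℝ, IsTestFunction T φ →
    (∀ t ∈ Ico 0 T, ∀ x ∈ closure Ω, 0 ≤ φ (t, x)) →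
    ∀ Z : ℝ → ℝ, ContDiff ℝ 1 Z → (∃ C : ℝ, ∀ s, |Z s| ≤ C) → (∀ s, 0 ≤ deriv Z s) →
    ∀ᵐ τ ∂(volume.restrict (Ico 0 T)),
    (∫ t in Ioo 0 τ, ∫ x in Ω,
        (ρ t x * Z (S t x / ρ t x) * timeDeriv φ t x
          + Z (S t x / ρ t x) * spaceDeriv φ t x (m t x))) ≤
      (∫ x in Ω, ρ τ x * Z (S τ x / ρ τ x) * φ (τ, x))
        - (∫ x in Ω, ρ₀ x * Z (S₀ x / ρ₀ x) * φ (0, x))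

/-! ### Stable approximations -/

/-- `(ρ n, m n, S n)` is a stable approximation of the complete Euler system in `(0,T) × Ω` with
initial data `[ρ₀, m₀, S₀]`. Since only an upper bound is asked for, the vanishing energy error
`e n` may be taken nonnegative (replace it by its absolute value). -/
structure IsStableApproximation {d : ℕ} (γ T : ℝ) (Ω : Set (Space d))
    (ρ₀ : Space d → ℝ) (m₀ : Space d → Space d) (S₀ : Space d → ℝ)
    (ρ : ℕ → ℝ → Space d → ℝ) (m : ℕ → ℝ → Space d → Space d) (S : ℕ → ℝ → Space d → ℝ) :
    Prop where
  measurable_density : ∀ n,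
    AEStronglyMeasurable (fun z : ℝ × Space d => ρ n z.1 z.2) (cylinderMeasure T Ω)
  measurable_momentum : ∀ n,
    AEStronglyMeasurable (fun z : ℝ × Space d => m n z.1 z.2) (cylinderMeasure T Ω)
  measurable_entropy : ∀ n,
    AEStronglyMeasurable (fun z : ℝ × Space d => S n z.1 z.2) (cylinderMeasure T Ω)
  density_nonneg : ∀ n, ∀ᵐ z ∂(cylinderMeasure T Ω), 0 ≤ ρ n z.1 z.2
  mass_bound : ∃ M : ℝ, ∀ n, ∀ᵐ τ ∂(volume.restrict (Ioo 0 T)),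
    IntegrableOn (ρ n τ) Ω ∧ ∫ x in Ω, ρ n τ x ≤ M
  entropy_bound : ∃ Sinf : ℝ, ∀ n, ∀ᵐ τ ∂(volume.restrict (Ioo 0 T)),
    IntegrableOn (S n τ) Ω ∧ Sinf ≤ ∫ x in Ω, S n τ x
  energy_bound : ∃ e : ℕ → ℝ≥0, Tendsto e atTop (𝓝 0) ∧
    ∀ n, ∀ᵐ τ ∂(volume.restrict (Ioo 0 T)),
      ∫⁻ x in Ω, totalEnergy γ (ρ n τ x) (m n τ x) (S n τ x) ≤
        (∫⁻ x in Ω, totalEnergy γ (ρ₀ x) (m₀ x) (S₀ x)) + e n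

/-! The engine is the convexity of the energy `E`. For a limit state `U` and approximations `Uₙ`,
the relative energy `E(Uₙ) - E(U) - E'(U)(Uₙ - U)` is nonnegative. If `U` is an admissible weak
solution, the energy balance tested with a function equal to one shows that the energy of `U` equals
the initial energy at every time (`IsAdmissibleWeakSolution.lintegral_energy_eq`). The energy bound
on the approximations, integrated in time, then gives `limsup ∫∫ E(Uₙ) ≤ ∫∫ E(U)`. Off a bite, and
where the coefficients of `E'(U)` are bounded, the linear term tends to zero by weak convergence.
Such sets exhaust the cylinder, so the relative energy tends to zero in `L¹` of each of them, and
a.e. along a subsequence (`tendsto_setIntegral_relative`, `exists_subseq_tendsto_ae_zero`).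

Away from the vacuum this determines the limit: written in density, velocity and temperature, the
relative energy is a sum of three nonnegative terms, one for each of these variables
(`relativeEnergy_of_pos`), and their vanishing forces convergence of the state.

In the vacuum `E` is constant in `S ≤ 0`, so the relative energy does not see negative entropies.
There the energy and the density bound `Sₙ` from above, while weak convergence makes the mean of
`Sₙ` tend to that of the limit, which is zero because `S = 0` on the vacuum. The two together give
convergence in `L¹` (`tendsto_setIntegral_vacuum`).

The biting limit exists because energy, mass and the lower entropy bound control all `L¹` norms
(`lintegral_enorm_le_of_energy`), and bounded sequences in `L¹` have biting limits
(`exists_subseq_isBitingLimit`). The latter is proved by truncating at slowly growing levels and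
biting off the sets where the truncation acts. -/

/-! ### Weak sequential compactness -/

/-- Componentwise bounded sequences of countable families in a separable Hilbert space have a
subsequence all of whose components converge weakly. -/
lemma exists_subseq_tendsto_inner {H : Type*} [NormedAddCommGroup H] [InnerProductSpace ℝ H]
    [CompleteSpace H] [TopologicalSpace.SeparableSpace H] {ι : Type*} [Countable ι]
    (u : ℕ → ι → H) (C : ι → ℝ) (hu : ∀ n i, ‖u n i‖ ≤ C i) :
    ∃ σ : ℕ → ℕ, StrictMono σ ∧ ∃ v : ι → H, ∀ i w,
      Tendsto (fun n => inner ℝ (u (σ n) i) w) atTop (𝓝 (inner ℝ (v i) w)) := by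
  let K : ι → Set (WeakDual ℝ H) := fun i =>
    WeakDual.toStrongDual ⁻¹' Metric.closedBall (0 : StrongDual ℝ H) (C i)
  have hK : ∀ i, IsCompact (K i) := fun i => WeakDual.isCompact_closedBall 0 (C i)
  have : ∀ i, CompactSpace (K i) := fun i => isCompact_iff_compactSpace.mp (hK i)
  have : ∀ i, TopologicalSpace.MetrizableSpace (K i) := fun i =>
    WeakDual.metrizable_of_isCompact ℝ H (K i) (hK i)
  let U : ℕ → (∀ i, K i) := fun n i =>
    ⟨StrongDual.toWeakDual (InnerProductSpace.toDual ℝ H (u n i)), by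
      simpa [K] using hu n i⟩
  obtain ⟨V, σ, hσ, hV⟩ := SeqCompactSpace.tendsto_subseq U
  refine ⟨σ, hσ, fun i => (InnerProductSpace.toDual ℝ H).symm (WeakDual.toStrongDual (V i).1), ?_⟩
  intro i w
  have h1 : Tendsto (fun n => (U (σ n) i).1) atTop (𝓝 (V i).1) :=
    (continuous_subtype_val.tendsto _).comp (tendsto_pi_nhds.mp hV i)
  have h2 := ((WeakDual.eval_continuous w).tendsto _).comp h1
  simpa [Function.comp_def, U] using h2

/-- Bounded sequences of countable families of functions on a finite measure space have a
subsequence all of whose components converge weakly in `L²`. -/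
lemma exists_subseq_tendsto_integral_mul {X : Type*} [MeasurableSpace X]
    [MeasurableSpace.CountablyGenerated X] (μ : Measure X) [IsFiniteMeasure μ] {ι : Type*}
    [Countable ι] (f : ℕ → ι → X → ℝ) (hf : ∀ n i, AEStronglyMeasurable (f n i) μ) (C : ι → ℝ)
    (hC : ∀ n i x, |f n i x| ≤ C i) :
    ∃ σ : ℕ → ℕ, StrictMono σ ∧ ∃ g : ι → X → ℝ, (∀ i, MemLp (g i) 2 μ) ∧
      ∀ i w, MemLp w 2 μ →
        Tendsto (fun n => ∫ x, w x * f (σ n) i x ∂μ) atTop (𝓝 (∫ x, w x * g i x ∂μ)) := by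
  have hL : ∀ n i, MemLp (f n i) 2 μ := fun n i =>
    MemLp.of_bound (hf n i) (C i) (ae_of_all _ fun x => by simpa using hC n i x)
  have : Fact ((2 : ℝ≥0∞) ≠ ⊤) := ⟨ENNReal.ofNat_ne_top⟩
  obtain ⟨σ, hσ, v, hv⟩ := exists_subseq_tendsto_inner (fun n i => (hL n i).toLp)
    (fun i => (μ.real univ) ^ ((2 : ℝ≥0∞).toReal)⁻¹ * C i) (fun n i => by
      -- If `X` is empty, `C i` may be negative; a point of `X` is what makes it nonnegative.
      by_cases h0 : μ = 0
      · subst h0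
        rw [Lp.norm_toLp]
        simp
      · have : (Set.univ : Set X).Nonempty := by
          by_contra h
          exact h0 (Measure.measure_univ_eq_zero.mp (by
            rw [Set.not_nonempty_iff_eq_empty.mp h]; simp))
        obtain ⟨x, -⟩ := this
        refine Lp.norm_le_of_ae_bound ((abs_nonneg _).trans (hC n i x)) ?_
        filter_upwards [(hL n i).coeFn_toLp] with y hy
        rw [hy]
        simpa using hC n i y)
  refine ⟨σ, hσ, fun i => v i, fun i => Lp.memLp _, fun i w hw => ?_⟩
  have h := hv i hw.toLp
  have e : ∀ a : Lp ℝ 2 μ, inner ℝ a hw.toLp = ∫ x, w x * a x ∂μ := fun a => by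
    rw [L2.inner_def]
    refine integral_congr_ae ?_
    filter_upwards [hw.coeFn_toLp] with x hx
    rw [hx]
    simp
  simp only [e] at h
  refine h.congr fun n => integral_congr_ae ?_
  filter_upwards [(hL (σ n) i).coeFn_toLp] with x hx
  rw [hx]

/-! ### Truncation and weak limits of truncated sequences -/

/-- Truncation: large values are replaced by zero. -/
noncomputable def truncZero {N : ℕ} (k : ℕ) (v : Fin N → ℝ) : Fin N → ℝ :=
  if ‖v‖ ≤ k then v else 0

lemma measurable_truncZero {N : ℕ} (k : ℕ) : Measurable (truncZero (N := N) k) :=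
  Measurable.ite (measurableSet_le measurable_norm measurable_const) measurable_id measurable_const

lemma norm_truncZero_le {N : ℕ} (k : ℕ) (v : Fin N → ℝ) : ‖truncZero k v‖ ≤ k := by
  unfold truncZero; split_ifs <;> simp_all

lemma norm_truncZero_le_norm {N : ℕ} (k : ℕ) (v : Fin N → ℝ) : ‖truncZero k v‖ ≤ ‖v‖ := by
  unfold truncZero; split_ifs <;> simp_all

/-- The difference of two truncations is either zero or all of the larger one. Thus `L¹` distances
between truncations are differences of `L¹` norms, which converge as numbers. -/
lemma norm_truncZero_sub {N : ℕ} {l k : ℕ} (h : l ≤ k) (v : Fin N → ℝ) :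
    ‖truncZero k v - truncZero l v‖ = ‖truncZero k v‖ - ‖truncZero l v‖ := by
  have : (l : ℝ) ≤ k := by exact_mod_cast h
  unfold truncZero
  split_ifs <;> simp
  linarith

section Truncation

variable {X : Type*} [MeasurableSpace X] {μ : Measure X} [IsFiniteMeasure μ] {N : ℕ}
  {f : ℕ → X → Fin N → ℝ} {Φ : ℕ → ℝ} {a : ℝ} {g : ℕ → Fin N → X → ℝ}

lemma integrable_truncZero {h : X → Fin N → ℝ} (hh : AEStronglyMeasurable h μ) (k : ℕ) :
    Integrable (fun x => truncZero k (h x)) μ :=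
  Integrable.of_bound
    ((measurable_truncZero k).comp_aemeasurable hh.aemeasurable).aestronglyMeasurable k
    (ae_of_all _ fun _ => norm_truncZero_le k _)

lemma integrable_truncZero_apply {h : X → Fin N → ℝ} (hh : AEStronglyMeasurable h μ) (k : ℕ)
    (i : Fin N) : Integrable (fun x => truncZero k (h x) i) μ :=
  (integrable_truncZero hh k).eval i

lemma abs_integral_mul_truncZero_sub_le {h : X → Fin N → ℝ} (hh : AEStronglyMeasurable h μ)
    {l k : ℕ} (hlk : l ≤ k) (i : Fin N) {w : X → ℝ} (hw : AEStronglyMeasurable w μ) {W : ℝ}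
    (hW : ∀ x, |w x| ≤ W) :
    |(∫ x, w x * truncZero k (h x) i ∂μ) - ∫ x, w x * truncZero l (h x) i ∂μ| ≤
      W * ((∫ x, ‖truncZero k (h x)‖ ∂μ) - ∫ x, ‖truncZero l (h x)‖ ∂μ) := by
  have hi : ∀ k, Integrable (fun x => w x * truncZero k (h x) i) μ := fun k =>
    (integrable_truncZero_apply hh k i).bdd_mul hw (ae_of_all _ hW)
  rw [← integral_sub (hi k) (hi l), ← integral_sub (integrable_truncZero hh k).norm
    (integrable_truncZero hh l).norm, ← integral_const_mul]
  refine norm_integral_le_of_norm_le (f := fun x => w x * truncZero k (h x) i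
    - w x * truncZero l (h x) i) (((integrable_truncZero hh k).norm.sub
    (integrable_truncZero hh l).norm).const_mul W) (ae_of_all _ fun x => ?_)
  rw [← mul_sub, Real.norm_eq_abs, abs_mul]
  have h1 := norm_le_pi_norm (truncZero k (h x) - truncZero l (h x)) i
  rw [norm_truncZero_sub hlk] at h1
  exact mul_le_mul (hW x) h1 (abs_nonneg _) ((abs_nonneg _).trans (hW x))

variable (hf : ∀ n, AEStronglyMeasurable (f n) μ)
  (hΦ : ∀ k, Tendsto (fun n => ∫ x, ‖truncZero k (f n x)‖ ∂μ) atTop (𝓝 (Φ k)))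
  (ha : Tendsto Φ atTop (𝓝 a))
  (hg : ∀ k i, MemLp (g k i) 2 μ)
  (hfg : ∀ k i w, MemLp w 2 μ → Tendsto (fun n => ∫ x, w x * truncZero k (f n x) i ∂μ) atTop
    (𝓝 (∫ x, w x * g k i x ∂μ)))

include hf hΦ hg hfg in
/-- The weak limits of two truncations are as close in `L¹` as the limits of their norms. -/
lemma integral_abs_sub_truncZero_limit_le {l k : ℕ} (hlk : l ≤ k) (i : Fin N) :
    ∫ x, |g k i x - g l i x| ∂μ ≤ Φ k - Φ l := by
  have hint : ∀ k, Integrable (g k i) μ := fun k => (hg k i).integrable one_le_two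
  set D : X → ℝ := fun x => ((hg k i).1.mk _ x) - ((hg l i).1.mk _ x) with hD
  have hDm : Measurable D :=
    (hg k i).1.stronglyMeasurable_mk.measurable.sub (hg l i).1.stronglyMeasurable_mk.measurable
  -- Testing with the sign of `g k i - g l i` turns the `L¹` norm into a weak limit.
  set w : X → ℝ := fun x => if 0 ≤ D x then 1 else -1 with hw
  have hwm : Measurable w :=
    Measurable.ite (measurableSet_le measurable_const hDm) measurable_const measurable_const
  have hwb : ∀ x, |w x| ≤ 1 := fun x => by
    simp only [hw]
    split_ifs <;> simp
  have hwL : MemLp w 2 μ := MemLp.of_bound hwm.aestronglyMeasurable 1 (ae_of_all _ hwb)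
  have hwi : ∀ k, Integrable (fun x => w x * g k i x) μ := fun k =>
    (hint k).bdd_mul hwm.aestronglyMeasurable (ae_of_all _ hwb)
  have e : ∫ x, |g k i x - g l i x| ∂μ = (∫ x, w x * g k i x ∂μ) - ∫ x, w x * g l i x ∂μ := by
    rw [← integral_sub (hwi k) (hwi l)]
    refine integral_congr_ae ?_
    filter_upwards [(hg k i).1.ae_eq_mk, (hg l i).1.ae_eq_mk] with x h1 h2
    simp only [hw, hD, ← h1, ← h2, ← mul_sub]
    split_ifs with h
    · rw [one_mul, abs_of_nonneg h]
    · rw [neg_one_mul, abs_of_neg (not_le.mp h)]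
  rw [e]
  refine le_of_tendsto_of_tendsto ((hfg k i w hwL).sub (hfg l i w hwL)) ((hΦ k).sub (hΦ l))
    (Eventually.of_forall fun n => ?_)
  have := abs_integral_mul_truncZero_sub_le (hf n) hlk i hwm.aestronglyMeasurable hwb
  rw [one_mul] at this
  exact (le_abs_self _).trans this

-- `Φ` converges, so by the previous estimate the weak limits `g k i` are Cauchy in `L¹`.
include hf hΦ ha hg hfg in
lemma exists_limit_truncZero_limit : ∃ G : Fin N → X → ℝ, (∀ i, Integrable (G i) μ) ∧
    ∀ i, Tendsto (fun k => ∫ x, |g k i x - G i x| ∂μ) atTop (𝓝 0) := by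
  have key : ∀ i, ∃ G : X → ℝ, Integrable G μ ∧
      Tendsto (fun k => ∫ x, |g k i x - G x| ∂μ) atTop (𝓝 0) := by
    intro i
    have hint : ∀ k, Integrable (g k i) μ := fun k => (hg k i).integrable one_le_two
    have hdist : ∀ {l k : ℕ}, l ≤ k → dist ((hint k).toL1) ((hint l).toL1) ≤ dist (Φ k) (Φ l) := by
      intro l k hlk
      rw [L1.dist_eq_integral_dist]
      refine (le_of_eq ?_).trans ((integral_abs_sub_truncZero_limit_le hf hΦ hg hfg hlk i).trans
        (le_abs_self _))
      refine integral_congr_ae ?_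
      filter_upwards [(hint k).coeFn_toL1, (hint l).coeFn_toL1] with x h1 h2
      rw [h1, h2, Real.dist_eq]
    have hc : CauchySeq fun k => (hint k).toL1 := by
      rw [Metric.cauchySeq_iff]
      intro ε hε
      obtain ⟨M, hM⟩ := Metric.cauchySeq_iff.mp ha.cauchySeq ε hε
      refine ⟨M, fun p hp q hq => ?_⟩
      rcases le_total q p with h | h
      · exact (hdist h).trans_lt (hM p hp q hq)
      · rw [dist_comm]
        exact (hdist h).trans_lt (hM q hq p hp)
    obtain ⟨G, hG⟩ := cauchySeq_tendsto_of_complete hc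
    refine ⟨G, L1.integrable_coeFn G, ?_⟩
    rw [tendsto_iff_dist_tendsto_zero] at hG
    refine hG.congr fun k => ?_
    rw [L1.dist_eq_integral_dist]
    refine integral_congr_ae ?_
    filter_upwards [(hint k).coeFn_toL1] with x h1
    rw [h1, Real.dist_eq]
  choose G h1 h2 using key
  exact ⟨G, h1, h2⟩

include hf hΦ ha hg hfg in
/-- If the truncation levels grow so slowly that no mass beyond the limit of the truncated norms is
seen, the truncated functions converge weakly in `L¹`. -/
lemma tendsto_integral_mul_truncZero {G : Fin N → X → ℝ} (hG : ∀ i, Integrable (G i) μ)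
    (hgG : ∀ i, Tendsto (fun k => ∫ x, |g k i x - G i x| ∂μ) atTop (𝓝 0)) {b : ℕ → ℕ}
    (hb : Tendsto b atTop atTop)
    (hba : Tendsto (fun n => ∫ x, ‖truncZero (b n) (f n x)‖ ∂μ) atTop (𝓝 a)) (i : Fin N)
    {w : X → ℝ} (hw : AEStronglyMeasurable w μ) {W : ℝ} (hW : ∀ x, |w x| ≤ W) :
    Tendsto (fun n => ∫ x, w x * truncZero (b n) (f n x) i ∂μ) atTop
      (𝓝 (∫ x, w x * G i x ∂μ)) := by
  have hint : ∀ k, Integrable (g k i) μ := fun k => (hg k i).integrable one_le_two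
  have hwL : MemLp w 2 μ := MemLp.of_bound hw W (ae_of_all _ hW)
  rw [Metric.tendsto_nhds]
  intro ε hε
  -- Three errors: the mass between levels `l` and `b n`, the weak convergence at level `l`, and the
  -- distance from `g l` to `G`. The level `l` is fixed first to make the limiting total small, then
  -- `n` is taken large.
  have hlim : Tendsto (fun l => W * (a - Φ l) + 0 + W * ∫ x, |g l i x - G i x| ∂μ) atTop
      (𝓝 (W * (a - a) + 0 + W * 0)) :=
    (((tendsto_const_nhds.sub ha).const_mul W).add tendsto_const_nhds).add ((hgG i).const_mul W)
  rw [sub_self, mul_zero, add_zero, add_zero] at hlim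
  obtain ⟨l, hl⟩ := (hlim.eventually_lt_const hε).exists
  have hlim2 : Tendsto (fun n => W * ((∫ x, ‖truncZero (b n) (f n x)‖ ∂μ)
      - ∫ x, ‖truncZero l (f n x)‖ ∂μ)
      + |(∫ x, w x * truncZero l (f n x) i ∂μ) - ∫ x, w x * g l i x ∂μ|
      + W * ∫ x, |g l i x - G i x| ∂μ) atTop
      (𝓝 (W * (a - Φ l) + 0 + W * ∫ x, |g l i x - G i x| ∂μ)) := by
    refine (((hba.sub (hΦ l)).const_mul W).add ?_).add tendsto_const_nhds
    have := ((hfg l i w hwL).sub_const (∫ x, w x * g l i x ∂μ)).abs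
    simpa using this
  filter_upwards [hlim2.eventually_lt_const hl, hb.eventually_ge_atTop l] with n hn hbn
  refine lt_of_le_of_lt ?_ hn
  have h1 := abs_integral_mul_truncZero_sub_le (hf n) hbn i hw hW
  have h2 : |(∫ x, w x * g l i x ∂μ) - ∫ x, w x * G i x ∂μ| ≤ W * ∫ x, |g l i x - G i x| ∂μ := by
    rw [← integral_sub ((hint l).bdd_mul hw (ae_of_all _ hW)) ((hG i).bdd_mul hw (ae_of_all _ hW)),
      ← integral_const_mul]
    refine norm_integral_le_of_norm_le (f := fun x => w x * g l i x - w x * G i x)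
      ((((hint l).sub (hG i)).abs).const_mul W) (ae_of_all _ fun x => ?_)
    rw [← mul_sub, Real.norm_eq_abs, abs_mul]
    exact mul_le_mul_of_nonneg_right (hW x) (abs_nonneg _)
  rw [Real.dist_eq]
  refine (abs_sub_le _ (∫ x, w x * g l i x ∂μ) _).trans (add_le_add ?_ h2)
  exact (abs_sub_le _ (∫ x, w x * truncZero l (f n x) i ∂μ) _).trans (add_le_add h1 le_rfl)

end Truncation

/-! ### Biting limits and the biting lemma -/

lemma IsBitingLimit.comp_strictMono {X F : Type*} [MeasurableSpace X] [NormedAddCommGroup F]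
    [NormedSpace ℝ F] {μ : Measure X} {f : ℕ → X → F} {g : X → F} (h : IsBitingLimit μ f g)
    {σ : ℕ → ℕ} (hσ : StrictMono σ) : IsBitingLimit μ (fun n => f (σ n)) g := by
  obtain ⟨h1, h2, B, hB, hBa, hB0, hw⟩ := h
  exact ⟨fun n => h1 _, h2, B, hB, hBa, hB0, fun k w hwm hwb =>
    (hw k w hwm hwb).comp hσ.tendsto_atTop⟩

lemma IsBitingLimit.clm_comp {X F G : Type*} [MeasurableSpace X] [NormedAddCommGroup F]
    [NormedSpace ℝ F] [CompleteSpace F] [NormedAddCommGroup G] [NormedSpace ℝ G] [CompleteSpace G]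
    {μ : Measure X} {f : ℕ → X → F} {g : X → F} (h : IsBitingLimit μ f g) (L : F →L[ℝ] G) :
    IsBitingLimit μ (fun n x => L (f n x)) (fun x => L (g x)) := by
  obtain ⟨h1, h2, B, hB, hBa, hB0, hw⟩ := h
  refine ⟨fun n => L.integrable_comp (h1 n), L.integrable_comp h2, B, hB, hBa, hB0,
    fun k w hwm ⟨C, hC⟩ => ?_⟩
  have e : ∀ h : X → F, Integrable h μ →
      ∫ x in (B k)ᶜ, w x • L (h x) ∂μ = L (∫ x in (B k)ᶜ, w x • h x ∂μ) := fun h hh => by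
    have hi : Integrable (fun x => w x • h x) (μ.restrict (B k)ᶜ) :=
      hh.restrict.bdd_smul (φ := w) C hwm.aestronglyMeasurable (ae_of_all _ hC)
    rw [← L.integral_comp_comm hi]
    simp
  simp only [e _ (h1 _), e _ h2]
  exact (L.continuous.tendsto _).comp (hw k w hwm ⟨C, hC⟩)

lemma tendsto_measure_iUnion_ge_zero {X : Type*} [MeasurableSpace X] {μ : Measure X}
    {s : ℕ → Set X} (hs : ∑' j, μ (s j) ≠ ⊤) :
    Tendsto (fun k => μ (⋃ j, s (j + k))) atTop (𝓝 0) :=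
  tendsto_of_tendsto_of_tendsto_of_le_of_le tendsto_const_nhds
    (ENNReal.tendsto_sum_nat_add _ hs) (fun _ => zero_le) fun _ => measure_iUnion_le _

section

variable {X : Type*} [MeasurableSpace X] [MeasurableSpace.CountablyGenerated X] {μ : Measure X}
  [IsFiniteMeasure μ] {N : ℕ}

/-- Three extractions: weak `L²` limits at all levels, limits of the truncated norms at all levels,
and a diagonal choice matching the level `2 ^ n` to an index at which the truncated norm is already
close to its limit. -/
lemma exists_subseq_truncZero (f : ℕ → X → Fin N → ℝ) (hf : ∀ n, Integrable (f n) μ) {C : ℝ}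
    (hC : ∀ n, ∫ x, ‖f n x‖ ∂μ ≤ C) :
    ∃ σ : ℕ → ℕ, StrictMono σ ∧ ∃ G : Fin N → X → ℝ, (∀ i, Integrable (G i) μ) ∧
      ∀ i w, AEStronglyMeasurable w μ → (∃ W, ∀ x, |w x| ≤ W) →
        Tendsto (fun n => ∫ x, w x * truncZero (2 ^ n) (f (σ n) x) i ∂μ) atTop
          (𝓝 (∫ x, w x * G i x ∂μ)) := by
  have hfm := fun n => (hf n).1
  obtain ⟨σ, hσ, g, hg, hfg⟩ := exists_subseq_tendsto_integral_mul μ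
    (fun n (p : ℕ × Fin N) x => truncZero p.1 (f n x) p.2)
    (fun n p => (integrable_truncZero_apply (hfm n) p.1 p.2).1) (fun p => p.1)
    (fun n p x => (norm_le_pi_norm _ _).trans (norm_truncZero_le _ _))
  have hφ : ∀ n k, (∫ x, ‖truncZero k (f n x)‖ ∂μ) ∈ Icc 0 C := fun n k =>
    ⟨integral_nonneg fun _ => norm_nonneg _,
      (integral_mono (integrable_truncZero (hfm n) k).norm (hf n).norm
        fun x => norm_truncZero_le_norm k _).trans (hC n)⟩
  have hcpt : CompactSpace (Icc 0 C) := inferInstance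
  obtain ⟨Φ', τ, hτ, hΦ'⟩ := SeqCompactSpace.tendsto_subseq
    (fun n k => (⟨_, hφ (σ n) k⟩ : Icc 0 C))
  set Φ : ℕ → ℝ := fun k => Φ' k with hΦdef
  have hΦ : ∀ k, Tendsto (fun n => ∫ x, ‖truncZero k (f (σ (τ n)) x)‖ ∂μ) atTop (𝓝 (Φ k)) :=
    fun k => (continuous_subtype_val.tendsto _).comp (tendsto_pi_nhds.mp hΦ' k)
  have hmono : Monotone Φ := fun l k hlk => le_of_tendsto_of_tendsto' (hΦ l) (hΦ k) fun n => by
    refine integral_mono (integrable_truncZero (hfm _) l).norm (integrable_truncZero (hfm _) k).norm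
      fun x => ?_
    have := norm_truncZero_sub hlk (f (σ (τ n)) x)
    have := norm_nonneg (truncZero k (f (σ (τ n)) x) - truncZero l (f (σ (τ n)) x))
    dsimp only
    linarith
  have ha := tendsto_atTop_ciSup hmono ⟨C, by rintro _ ⟨k, rfl⟩; exact (Φ' k).2.2⟩
  set a := ⨆ k, Φ k
  -- The index for level `2 ^ j` is so large that the truncated norm is within `1 / (j + 1)` of `Φ
  -- (2 ^ j)`; hence it tends to `a`.
  obtain ⟨υ, hυ, hυ2⟩ := extraction_forall_of_eventually
    (P := fun j n => dist (∫ x, ‖truncZero (2 ^ j) (f (σ (τ n)) x)‖ ∂μ) (Φ (2 ^ j))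
      < 1 / ((j : ℝ) + 1))
    fun j => (Metric.tendsto_nhds.mp (hΦ (2 ^ j))) _ Nat.one_div_pos_of_nat
  have hpow : Tendsto (fun j : ℕ => 2 ^ j) atTop atTop :=
    tendsto_pow_atTop_atTop_of_one_lt one_lt_two
  have hba : Tendsto (fun j => ∫ x, ‖truncZero (2 ^ j) (f (σ (τ (υ j))) x)‖ ∂μ) atTop (𝓝 a) := by
    refine (tendsto_iff_of_dist ?_).mp (ha.comp hpow)
    refine squeeze_zero (fun _ => dist_nonneg) (fun j => ?_) tendsto_one_div_add_atTop_nhds_zero_nat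
    rw [dist_comm]
    exact (hυ2 j).le
  have hΦ2 := fun k => (hΦ k).comp hυ.tendsto_atTop
  have hfg2 : ∀ k i w, MemLp w 2 μ → Tendsto
      (fun n => ∫ x, w x * truncZero k (f (σ (τ (υ n))) x) i ∂μ) atTop
        (𝓝 (∫ x, w x * g (k, i) x ∂μ)) := fun k i w hw =>
    (hfg (k, i) w hw).comp (hτ.comp hυ).tendsto_atTop
  obtain ⟨G, hG, hgG⟩ := exists_limit_truncZero_limit (f := fun n => f (σ (τ (υ n))))
    (g := fun k i => g (k, i)) (fun n => hfm _) hΦ2 ha (fun k i => hg (k, i)) hfg2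
  refine ⟨fun n => σ (τ (υ n)), hσ.comp (hτ.comp hυ), G, hG, fun i w hw ⟨W, hW⟩ => ?_⟩
  exact tendsto_integral_mul_truncZero (f := fun n => f (σ (τ (υ n)))) (g := fun k i => g (k, i))
    (fun n => hfm _) hΦ2 ha (fun k i => hg (k, i)) hfg2 hG hgG hpow hba i hw hW

/-- By Chebyshev, the sets where the `j`-th function reaches `2 ^ j` have summable measures. The
bites are unions of their tails; off the `k`-th bite, truncation changes nothing from index `k` on.
-/
lemma exists_subseq_isBitingLimit_pi (f : ℕ → X → Fin N → ℝ) (hf : ∀ n, Integrable (f n) μ) {C : ℝ}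
    (hC : ∀ n, ∫ x, ‖f n x‖ ∂μ ≤ C) :
    ∃ σ : ℕ → ℕ, StrictMono σ ∧ ∃ G : X → Fin N → ℝ, IsBitingLimit μ (fun n => f (σ n)) G := by
  obtain ⟨σ, hσ, G, hG, hw⟩ := exists_subseq_truncZero f hf hC
  -- Bites must be genuinely measurable, hence the measurable representative.
  set s : ℕ → Set X := fun j => {x | (2 : ℝ) ^ j ≤ ‖(hf (σ j)).1.mk _ x‖} with hs
  have hsm : ∀ j, MeasurableSet (s j) := fun j =>
    measurableSet_le measurable_const (hf (σ j)).1.stronglyMeasurable_mk.measurable.norm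
  have hsμ : ∀ j, μ (s j) ≤ ENNReal.ofReal C * (1 / 2) ^ j := fun j => by
    have hi : Integrable ((hf (σ j)).1.mk _) μ := (hf (σ j)).congr (hf (σ j)).1.ae_eq_mk
    have h1 := mul_meas_ge_le_integral_of_nonneg (ae_of_all μ fun x => norm_nonneg _) hi.norm
      ((2 : ℝ) ^ j)
    have h2 : ∫ x, ‖(hf (σ j)).1.mk _ x‖ ∂μ ≤ C := by
      refine (integral_congr_ae ?_).le.trans (hC (σ j))
      filter_upwards [(hf (σ j)).1.ae_eq_mk] with x hx
      rw [← hx]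
    have h3 : μ.real (s j) ≤ C * (1 / 2) ^ j := by
      have h4 : (2 : ℝ) ^ j * (1 / 2) ^ j = 1 := by rw [← mul_pow]; norm_num
      calc μ.real (s j) = (2 ^ j * μ.real (s j)) * (1 / 2) ^ j := by
            linear_combination (-μ.real (s j)) * h4
        _ ≤ C * (1 / 2) ^ j := mul_le_mul_of_nonneg_right (h1.trans h2) (by positivity)
    rw [← ofReal_measureReal]
    refine (ENNReal.ofReal_le_ofReal h3).trans (le_of_eq ?_)
    have : (1 / 2 : ℝ≥0∞) = ENNReal.ofReal (1 / 2) := by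
      rw [ENNReal.ofReal_div_of_pos two_pos]; simp
    rw [this, ← ENNReal.ofReal_pow (by norm_num), ← ENNReal.ofReal_mul']
    positivity
  have hsum : ∑' j, μ (s j) ≠ ⊤ := by
    refine ne_top_of_le_ne_top ?_ (ENNReal.tsum_le_tsum hsμ)
    rw [ENNReal.tsum_mul_left, ENNReal.tsum_geometric]
    refine ENNReal.mul_ne_top ENNReal.ofReal_ne_top ?_
    simp
  refine ⟨σ, hσ, fun x i => G i x, fun n => hf _, Integrable.of_eval hG, fun k => ⋃ j, s (j + k),
    fun k => MeasurableSet.iUnion fun j => hsm _, ?_, tendsto_measure_iUnion_ge_zero hsum, ?_⟩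
  · intro k l hkl
    refine iUnion_subset fun j => ?_
    have : j + l = (j + (l - k)) + k := by omega
    rw [this]
    exact subset_iUnion (fun j => s (j + k)) (j + (l - k))
  · rintro k w hwm ⟨W, hW⟩
    have hA : MeasurableSet (⋃ j, s (j + k))ᶜ := (MeasurableSet.iUnion fun j => hsm _).compl
    set A := (⋃ j, s (j + k))ᶜ with hAdef
    have hint : ∀ h : X → Fin N → ℝ, (∀ i, Integrable (fun x => h x i) μ) → ∀ i,
        (∫ x in A, w x • h x ∂μ) i = ∫ x, A.indicator w x * h x i ∂μ := fun h hh i => by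
      rw [eval_integral (fun i => ?_)]
      · rw [← integral_indicator hA]
        congr 1 with x
        by_cases hx : x ∈ A <;> simp [hx]
      · exact (hh i).restrict.bdd_mul hwm.aestronglyMeasurable (ae_of_all _ hW)
    rw [tendsto_pi_nhds]
    intro i
    rw [hint (fun x i => G i x) hG i]
    have hfi := fun n i => (hf (σ n)).eval i
    refine (hw i (A.indicator w) (hwm.indicator hA).aestronglyMeasurable ⟨W, fun x => ?_⟩).congr' ?_
    · by_cases hx : x ∈ A
      · simpa [hx] using hW x
      · simpa [hx] using (abs_nonneg _).trans (hW x)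
    · filter_upwards [eventually_ge_atTop k] with n hn
      rw [hint (fun x i => f (σ n) x i) (hfi n) i]
      refine integral_congr_ae ?_
      filter_upwards [(hf (σ n)).1.ae_eq_mk] with x hx
      by_cases hxA : x ∈ A
      · have h1 : x ∉ s n := fun h => hxA (mem_iUnion.mpr ⟨n - k, by
          rwa [Nat.sub_add_cancel hn]⟩)
        have h2 : ‖f (σ n) x‖ ≤ ((2 ^ n : ℕ) : ℝ) := by
          rw [hx]
          push_cast
          exact (not_le.mp h1).le
        rw [truncZero, if_pos h2]
      · simp [hxA]

/-- **Biting lemma** of Brooks and Chacon: a sequence bounded in `L¹` of a finite measure has a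
subsequence with a biting limit. -/
theorem exists_subseq_isBitingLimit {F : Type*} [NormedAddCommGroup F] [NormedSpace ℝ F]
    [FiniteDimensional ℝ F] (f : ℕ → X → F) (hf : ∀ n, Integrable (f n) μ) {C : ℝ}
    (hC : ∀ n, ∫ x, ‖f n x‖ ∂μ ≤ C) :
    ∃ σ : ℕ → ℕ, StrictMono σ ∧ ∃ G : X → F, IsBitingLimit μ (fun n => f (σ n)) G := by
  have : CompleteSpace F := FiniteDimensional.complete ℝ F
  let L : F ≃L[ℝ] (Fin (Module.finrank ℝ F) → ℝ) := ContinuousLinearEquiv.ofFinrankEq (by simp)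
  have hLf : ∀ n, Integrable (fun x => L (f n x)) μ := fun n =>
    (L : F →L[ℝ] (Fin (Module.finrank ℝ F) → ℝ)).integrable_comp (hf n)
  obtain ⟨σ, hσ, G, hG⟩ := exists_subseq_isBitingLimit_pi (fun n x => L (f n x)) hLf
    (C := ‖(L : F →L[ℝ] (Fin (Module.finrank ℝ F) → ℝ))‖ * C) fun n => by
      refine (integral_mono (hLf n).norm ((hf n).norm.const_mul _) fun x =>
        (L : F →L[ℝ] (Fin (Module.finrank ℝ F) → ℝ)).le_opNorm _).trans ?_
      rw [integral_const_mul]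
      exact mul_le_mul_of_nonneg_left (hC n) (norm_nonneg _)
  refine ⟨σ, hσ, fun x => L.symm (G x), ?_⟩
  simpa using hG.clm_comp (L.symm : (Fin (Module.finrank ℝ F) → ℝ) →L[ℝ] F)

end

/-! ### The energy functional -/

/-- The absolute temperature, as a function of density and total entropy. -/
noncomputable def temperature (γ ρ S : ℝ) : ℝ :=
  Real.exp ((γ - 1) * (Real.log ρ + S / ρ))

lemma temperature_pos (γ ρ S : ℝ) : 0 < temperature γ ρ S := Real.exp_pos _

/-- In this normalisation the temperature is the specific internal energy. Its logarithm is affine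
in `log ρ` and `S / ρ`, which makes the relative energy explicit. -/
lemma internalEnergy_eq {γ ρ : ℝ} (hρ : 0 < ρ) (S : ℝ) :
    internalEnergy γ ρ S = ρ * temperature γ ρ S := by
  have h1 : S / (heatCv γ * ρ) = (γ - 1) * (S / ρ) := by
    unfold heatCv
    rw [one_div, div_mul_eq_div_div, div_inv_eq_mul]
    ring
  have h2 : ρ ^ γ = ρ * Real.exp ((γ - 1) * Real.log ρ) := by
    nth_rw 2 [← Real.exp_log hρ]
    rw [← Real.exp_add, Real.rpow_def_of_pos hρ]
    ring_nf
  rw [internalEnergy, temperature, h1, h2, mul_assoc, ← Real.exp_add]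
  ring_nf

section Energy

variable {d : ℕ} {γ : ℝ}

lemma totalEnergy_toReal_of_pos {ρ : ℝ} (hρ : 0 < ρ) (m : Space d) (S : ℝ) :
    (totalEnergy γ ρ m S).toReal = ‖m‖ ^ 2 / (2 * ρ) + ρ * temperature γ ρ S := by
  have := temperature_pos γ ρ S
  rw [totalEnergy, if_pos hρ, internalEnergy_eq hρ, ENNReal.toReal_ofReal]
  positivity

lemma totalEnergy_ne_top_cases {ρ : ℝ} {m : Space d} {S : ℝ} (h : totalEnergy γ ρ m S ≠ ⊤) :
    0 < ρ ∨ (ρ = 0 ∧ m = 0 ∧ S ≤ 0 ∧ totalEnergy γ ρ m S = 0) := by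
  unfold totalEnergy at *
  split_ifs at * with h1 h2
  · exact Or.inl h1
  · exact Or.inr ⟨h2.1, h2.2.1, h2.2.2, rfl⟩
  · exact absurd rfl h

lemma density_nonneg_of_totalEnergy_ne_top {ρ : ℝ} {m : Space d} {S : ℝ}
    (h : totalEnergy γ ρ m S ≠ ⊤) : 0 ≤ ρ := by
  rcases totalEnergy_ne_top_cases h with h | h
  · exact h.le
  · exact h.1.ge

lemma measurable_totalEnergy :
    Measurable fun p : ℝ × Space d × ℝ => totalEnergy γ p.1 p.2.1 p.2.2 := by
  unfold totalEnergy internalEnergy heatCv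
  refine Measurable.ite (measurableSet_lt measurable_const measurable_fst) ?_
    (Measurable.ite ?_ measurable_const measurable_const)
  · fun_prop
  · refine (measurable_fst (measurableSet_singleton (0 : ℝ))).inter
      (MeasurableSet.inter ?_ (measurableSet_le measurable_snd.snd measurable_const))
    exact measurable_snd.fst (measurableSet_singleton (0 : Space d))

/-- The energy controls the momentum. -/
lemma norm_momentum_le {ρ : ℝ} {m : Space d} {S : ℝ} (h : totalEnergy γ ρ m S ≠ ⊤) :
    ‖m‖ ≤ (totalEnergy γ ρ m S).toReal + ρ / 2 := by
  rcases totalEnergy_ne_top_cases h with hρ | ⟨h1, h2, -, h4⟩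
  · rw [totalEnergy_toReal_of_pos hρ]
    have h1 := temperature_pos γ ρ S
    have h2 : ‖m‖ ^ 2 / (2 * ρ) + ρ / 2 - ‖m‖ = (‖m‖ - ρ) ^ 2 / (2 * ρ) := by
      field_simp
      ring
    have h3 : 0 ≤ (‖m‖ - ρ) ^ 2 / (2 * ρ) := by positivity
    have h4 := mul_pos hρ h1
    linarith
  · simp [h1, h2]

/-- The energy controls the positive part of the total entropy. -/
lemma entropy_le {ρ : ℝ} {m : Space d} {S : ℝ} (hγ : 1 < γ) (h : totalEnergy γ ρ m S ≠ ⊤) {ε : ℝ}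
    (hε : 0 < ε) :
    S ≤ (totalEnergy γ ρ m S).toReal / (γ - 1) + (ε + ρ * |Real.log ε|) := by
  rcases totalEnergy_ne_top_cases h with hρ | ⟨h1, h2, h3, h4⟩
  · rw [totalEnergy_toReal_of_pos hρ]
    have hγ' : 0 < γ - 1 := sub_pos.mpr hγ
    have h1 : (γ - 1) * (Real.log ρ + S / ρ) + 1 ≤ temperature γ ρ S := Real.add_one_le_exp _
    -- The tangent inequality of the exponential leaves `-ρ log ρ`. Bounding it with a free `ε`
    -- keeps the additive constant small, at the price of a large factor on the density, which
    -- vanishes in the limit on vacuum sets.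
    have h2 : Real.log (ε / ρ) ≤ ε / ρ - 1 := Real.log_le_sub_one_of_pos (div_pos hε hρ)
    rw [Real.log_div hε.ne' hρ.ne'] at h2
    have h3 : S / ρ ≤ temperature γ ρ S / (γ - 1) - Real.log ρ := by
      rw [le_sub_iff_add_le, le_div_iff₀ hγ']
      linarith
    have h4 : S = ρ * (S / ρ) := by field_simp
    have h5 : S / ρ ≤ temperature γ ρ S / (γ - 1) + (ε / ρ + |Real.log ε|) := by
      have := neg_abs_le (Real.log ε)
      linarith
    have h6 := mul_le_mul_of_nonneg_left h5 hρ.le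
    have h7 : ρ * (temperature γ ρ S / (γ - 1) + (ε / ρ + |Real.log ε|))
        = ρ * temperature γ ρ S / (γ - 1) + (ε + ρ * |Real.log ε|) := by field_simp
    rw [← h4, h7] at h6
    refine h6.trans (add_le_add_left ?_ _)
    gcongr
    have : 0 ≤ ‖m‖ ^ 2 / (2 * ρ) := by positivity
    linarith
  · rw [h4, h1]
    simp only [ENNReal.toReal_zero, zero_div, zero_mul, add_zero, zero_add]
    linarith

/-! ### The relative energy -/

/-- Derivative of the energy in the density, extended by zero to the vacuum. -/
noncomputable def gradDensity (γ ρ : ℝ) (m : Space d) (S : ℝ) : ℝ :=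
  if 0 < ρ then temperature γ ρ S * (γ - (γ - 1) * (S / ρ)) - ‖m‖ ^ 2 / (2 * ρ ^ 2) else 0

/-- Derivative of the energy in the momentum, extended by zero to the vacuum. -/
noncomputable def gradMomentum (ρ : ℝ) (m : Space d) : Space d :=
  if 0 < ρ then ρ⁻¹ • m else 0

/-- Derivative of the energy in the entropy, extended by zero to the vacuum. -/
noncomputable def gradEntropy (γ ρ S : ℝ) : ℝ :=
  if 0 < ρ then (γ - 1) * temperature γ ρ S else 0

/-- The linear part of the energy at the state `(ρ, m, S)`, evaluated at an increment. -/
noncomputable def energyDeriv (γ ρ : ℝ) (m : Space d) (S ρ' : ℝ) (m' : Space d) (S' : ℝ) : ℝ :=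
  gradDensity γ ρ m S * ρ' + inner ℝ (gradMomentum ρ m) m' + gradEntropy γ ρ S * S'

/-- The relative energy of the state `(ρ', m', S')` with respect to `(ρ, m, S)`. -/
noncomputable def relativeEnergy (γ ρ : ℝ) (m : Space d) (S ρ' : ℝ) (m' : Space d) (S' : ℝ) : ℝ :=
  (totalEnergy γ ρ' m' S').toReal - (totalEnergy γ ρ m S).toReal
    - energyDeriv γ ρ m S (ρ' - ρ) (m' - m) (S' - S)

/-- Multiply `1 - 1/√x ≤ log √x` by `2x`. The square on the left gives a bound whose vanishing
forces `x → 1`; it also covers `x = 0`. -/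
lemma sq_sqrt_sub_one_le_mul_log {x : ℝ} (hx : 0 ≤ x) :
    (√x - 1) ^ 2 ≤ x * Real.log x - x + 1 := by
  rcases hx.eq_or_lt with rfl | hx
  · simp
  · have h1 := Real.one_sub_inv_le_log_of_pos (Real.sqrt_pos.mpr hx)
    rw [Real.log_sqrt hx.le] at h1
    have h2 := Real.sq_sqrt hx.le
    have h3 := mul_le_mul_of_nonneg_left h1 hx.le
    have h4 : x * (1 - (√x)⁻¹) = x - √x := by
      have := (Real.sqrt_pos.mpr hx).ne'
      field_simp
      nlinarith
    rw [h4] at h3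
    nlinarith

lemma sq_sqrt_sub_one_le_sub_log {x : ℝ} (hx : 0 < x) :
    (√x - 1) ^ 2 ≤ x - 1 - Real.log x := by
  have h1 := Real.log_le_sub_one_of_pos (Real.sqrt_pos.mpr hx)
  rw [Real.log_sqrt hx.le] at h1
  have h2 := Real.sq_sqrt hx.le
  nlinarith

/-- The gradient of `E` is explicit and `log θ` is affine in `log ρ` and `S / ρ`, so the identity is
algebra. Each summand on the right is nonnegative when `γ > 1`, which gives both convexity and the
separate control of velocity, temperature and density. -/
lemma relativeEnergy_of_pos {ρ ρ' : ℝ} (hρ : 0 < ρ) (hρ' : 0 < ρ') (m m' : Space d) (S S' : ℝ) :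
    relativeEnergy γ ρ m S ρ' m' S' =
      ρ' / 2 * ‖ρ'⁻¹ • m' - ρ⁻¹ • m‖ ^ 2
      + ρ' * temperature γ ρ S * (temperature γ ρ' S' / temperature γ ρ S - 1
          - Real.log (temperature γ ρ' S' / temperature γ ρ S))
      + (γ - 1) * (ρ * temperature γ ρ S) * (ρ' / ρ * Real.log (ρ' / ρ) - ρ' / ρ + 1) := by
  have hθ := temperature_pos γ ρ S
  have hlog : Real.log (temperature γ ρ' S' / temperature γ ρ S)
      = (γ - 1) * (Real.log ρ' + S' / ρ') - (γ - 1) * (Real.log ρ + S / ρ) := by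
    rw [Real.log_div (temperature_pos _ _ _).ne' hθ.ne', temperature, temperature, Real.log_exp,
      Real.log_exp]
  rw [relativeEnergy, energyDeriv, totalEnergy_toReal_of_pos hρ, totalEnergy_toReal_of_pos hρ',
    gradDensity, gradMomentum, gradEntropy, if_pos hρ, if_pos hρ, if_pos hρ, hlog,
    Real.log_div hρ'.ne' hρ.ne', norm_sub_sq_real, norm_smul, norm_smul, inner_sub_right,
    real_inner_smul_left, real_inner_smul_left, real_inner_smul_left, real_inner_smul_right,
    real_inner_self_eq_norm_sq, Real.norm_of_nonneg (inv_pos.mpr hρ).le,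
    Real.norm_of_nonneg (inv_pos.mpr hρ').le, real_inner_comm m' m]
  field_simp
  ring

lemma relativeEnergy_vacuum {ρ : ℝ} (hρ : 0 < ρ) (m : Space d) (S : ℝ) {S' : ℝ} (hS' : S' ≤ 0) :
    relativeEnergy γ ρ m S 0 0 S' = (γ - 1) * temperature γ ρ S * (ρ - S') := by
  have h0 : totalEnergy γ 0 (0 : Space d) S' = 0 := by simp [totalEnergy, hS']
  rw [relativeEnergy, energyDeriv, totalEnergy_toReal_of_pos hρ, h0,
    gradDensity, gradMomentum, gradEntropy, if_pos hρ, if_pos hρ, if_pos hρ, inner_sub_right,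
    real_inner_smul_left, real_inner_smul_left, real_inner_self_eq_norm_sq, inner_zero_right,
    ENNReal.toReal_zero]
  field_simp
  ring

/-- Vacuum is admitted for the primed state. This bound therefore comes first: it shows that nearby
states are not vacuum, after which the temperature and velocity bounds apply. -/
lemma relativeEnergy_ge_density {ρ ρ' : ℝ} (hγ : 1 < γ) (hρ : 0 < ρ) (m m' : Space d) (S S' : ℝ)
    (h : totalEnergy γ ρ' m' S' ≠ ⊤) :
    (γ - 1) * (ρ * temperature γ ρ S) * (√(ρ' / ρ) - 1) ^ 2 ≤
      relativeEnergy γ ρ m S ρ' m' S' := by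
  have hθ := temperature_pos γ ρ S
  have hγ' : 0 < γ - 1 := sub_pos.mpr hγ
  rcases totalEnergy_ne_top_cases h with hρ' | ⟨rfl, rfl, h3, -⟩
  · rw [relativeEnergy_of_pos hρ hρ']
    have h1 := sq_sqrt_sub_one_le_mul_log (div_pos hρ' hρ).le
    have h2 := sq_sqrt_sub_one_le_sub_log (div_pos (temperature_pos γ ρ' S') hθ)
    have h3 := mul_le_mul_of_nonneg_left h1 (mul_pos hγ' (mul_pos hρ hθ)).le
    have h4 := mul_nonneg (mul_pos hρ' hθ).le ((sq_nonneg _).trans h2)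
    have h5 : 0 ≤ ρ' / 2 * ‖ρ'⁻¹ • m' - ρ⁻¹ • m‖ ^ 2 := by positivity
    linarith
  · rw [relativeEnergy_vacuum hρ m S h3]
    have h4 := mul_pos hγ' hθ
    simp only [zero_div, Real.sqrt_zero]
    nlinarith

lemma relativeEnergy_ge_temperature {ρ ρ' : ℝ} (hγ : 1 < γ) (hρ : 0 < ρ) (hρ' : 0 < ρ')
    (m m' : Space d) (S S' : ℝ) :
    ρ' * temperature γ ρ S * (√(temperature γ ρ' S' / temperature γ ρ S) - 1) ^ 2 ≤
      relativeEnergy γ ρ m S ρ' m' S' := by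
  have hθ := temperature_pos γ ρ S
  have hγ' : 0 < γ - 1 := sub_pos.mpr hγ
  rw [relativeEnergy_of_pos hρ hρ']
  have h1 := sq_sqrt_sub_one_le_mul_log (div_pos hρ' hρ).le
  have h2 := sq_sqrt_sub_one_le_sub_log (div_pos (temperature_pos γ ρ' S') hθ)
  have h3 := mul_nonneg (mul_pos hγ' (mul_pos hρ hθ)).le ((sq_nonneg _).trans h1)
  have h4 := mul_le_mul_of_nonneg_left h2 (mul_pos hρ' hθ).le
  have h5 : 0 ≤ ρ' / 2 * ‖ρ'⁻¹ • m' - ρ⁻¹ • m‖ ^ 2 := by positivity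
  linarith

lemma relativeEnergy_ge_velocity {ρ ρ' : ℝ} (hγ : 1 < γ) (hρ : 0 < ρ) (hρ' : 0 < ρ')
    (m m' : Space d) (S S' : ℝ) :
    ρ' / 2 * ‖ρ'⁻¹ • m' - ρ⁻¹ • m‖ ^ 2 ≤ relativeEnergy γ ρ m S ρ' m' S' := by
  have hθ := temperature_pos γ ρ S
  have hγ' : 0 < γ - 1 := sub_pos.mpr hγ
  rw [relativeEnergy_of_pos hρ hρ']
  have h1 := sq_sqrt_sub_one_le_mul_log (div_pos hρ' hρ).le
  have h2 := sq_sqrt_sub_one_le_sub_log (div_pos (temperature_pos γ ρ' S') hθ)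
  have h3 := mul_nonneg (mul_pos hγ' (mul_pos hρ hθ)).le ((sq_nonneg _).trans h1)
  have h4 := mul_nonneg (mul_pos hρ' hθ).le ((sq_nonneg _).trans h2)
  linarith

/-- The energy vanishes at a vacuum state, its minimum, so the zero gradient used there is a
subgradient. -/
lemma relativeEnergy_at_vacuum {m : Space d} {S : ℝ} (h : totalEnergy γ 0 m S ≠ ⊤) (ρ' : ℝ)
    (m' : Space d) (S' : ℝ) :
    relativeEnergy γ 0 m S ρ' m' S' = (totalEnergy γ ρ' m' S').toReal := by
  rcases totalEnergy_ne_top_cases h with h | ⟨-, -, -, h4⟩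
  · exact absurd h (lt_irrefl 0)
  · simp [relativeEnergy, energyDeriv, gradDensity, gradMomentum, gradEntropy, h4]

lemma relativeEnergy_nonneg {ρ ρ' : ℝ} (hγ : 1 < γ) {m m' : Space d} {S S' : ℝ}
    (h : totalEnergy γ ρ m S ≠ ⊤) (h' : totalEnergy γ ρ' m' S' ≠ ⊤) :
    0 ≤ relativeEnergy γ ρ m S ρ' m' S' := by
  rcases totalEnergy_ne_top_cases h with hρ | ⟨rfl, -⟩
  · refine le_trans ?_ (relativeEnergy_ge_density hγ hρ m m' S S' h')
    have := temperature_pos γ ρ S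
    have hγ' : 0 < γ - 1 := sub_pos.mpr hγ
    positivity
  · rw [relativeEnergy_at_vacuum h]
    exact ENNReal.toReal_nonneg

lemma tendsto_of_sq_sqrt_sub_one {u v : ℕ → ℝ} {c : ℝ} (hc : 0 < c) (hu : ∀ᶠ n in atTop, 0 ≤ u n)
    (h : ∀ᶠ n in atTop, c * (√(u n) - 1) ^ 2 ≤ v n) (hv : Tendsto v atTop (𝓝 0)) :
    Tendsto u atTop (𝓝 1) := by
  have h1 : Tendsto (fun n => (√(u n) - 1) ^ 2) atTop (𝓝 0) := by
    have h2 : Tendsto (fun n => v n / c) atTop (𝓝 0) := by simpa using hv.div_const c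
    refine tendsto_of_tendsto_of_tendsto_of_le_of_le' tendsto_const_nhds h2
      (Eventually.of_forall fun _ => sq_nonneg _) ?_
    filter_upwards [h] with n hn
    rw [le_div_iff₀ hc]
    linarith
  have h3 : Tendsto (fun n => √(u n) - 1) atTop (𝓝 0) := by
    rw [tendsto_zero_iff_abs_tendsto_zero]
    have := h1.sqrt
    simpa [Function.comp_def, Real.sqrt_sq_eq_abs] using this
  have h4 : Tendsto (fun n => √(u n) ^ 2) atTop (𝓝 1) := by
    simpa using (h3.add_const 1).pow 2
  refine h4.congr' ?_
  filter_upwards [hu] with n hn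
  exact Real.sq_sqrt hn

/-- States whose relative energy with respect to a non-vacuum state tends to zero converge. -/
lemma tendsto_of_relativeEnergy {ρ : ℝ} {m : Space d} {S : ℝ} (hγ : 1 < γ) (hρ : 0 < ρ)
    {ρ' : ℕ → ℝ} {m' : ℕ → Space d} {S' : ℕ → ℝ}
    (hE : ∀ n, totalEnergy γ (ρ' n) (m' n) (S' n) ≠ ⊤)
    (hR : Tendsto (fun n => relativeEnergy γ ρ m S (ρ' n) (m' n) (S' n)) atTop (𝓝 0)) :
    Tendsto ρ' atTop (𝓝 ρ) ∧ Tendsto m' atTop (𝓝 m) ∧ Tendsto S' atTop (𝓝 S) := by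
  have hθ := temperature_pos γ ρ S
  have hγ' : 0 < γ - 1 := sub_pos.mpr hγ
  have h1 : Tendsto (fun n => ρ' n / ρ) atTop (𝓝 1) :=
    tendsto_of_sq_sqrt_sub_one (mul_pos hγ' (mul_pos hρ hθ))
      (Eventually.of_forall fun n =>
        div_nonneg (density_nonneg_of_totalEnergy_ne_top (hE n)) hρ.le)
      (Eventually.of_forall fun n => relativeEnergy_ge_density hγ hρ m (m' n) S (S' n) (hE n)) hR
  have h2 : Tendsto ρ' atTop (𝓝 ρ) := by
    have := h1.mul_const ρ
    simpa [div_mul_cancel₀ _ hρ.ne'] using this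
  -- This keeps the factor `ρ'` in the temperature and velocity bounds away from zero.
  have hpos : ∀ᶠ n in atTop, ρ / 2 < ρ' n := h2.eventually_const_lt (by linarith)
  have hlogρ : Tendsto (fun n => Real.log (ρ' n)) atTop (𝓝 (Real.log ρ)) := h2.log hρ.ne'
  have h3 : Tendsto (fun n => temperature γ (ρ' n) (S' n) / temperature γ ρ S) atTop (𝓝 1) := by
    refine tendsto_of_sq_sqrt_sub_one (c := ρ / 2 * temperature γ ρ S) (by positivity)
      (Eventually.of_forall fun n => (div_pos (temperature_pos _ _ _) hθ).le) ?_ hR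
    filter_upwards [hpos] with n hn
    refine le_trans ?_ (relativeEnergy_ge_temperature hγ hρ (by linarith) m (m' n) S (S' n))
    gcongr
  have h4 : Tendsto (fun n => (γ - 1) * (Real.log (ρ' n) + S' n / ρ' n)) atTop
      (𝓝 ((γ - 1) * (Real.log ρ + S / ρ))) := by
    have h5 := (h3.mul_const (temperature γ ρ S)).log (by positivity)
    simpa [div_mul_cancel₀ _ hθ.ne', temperature, Real.log_exp] using h5
  have h5 : Tendsto (fun n => S' n / ρ' n) atTop (𝓝 (S / ρ)) := by
    have := (h4.div_const (γ - 1)).sub hlogρ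
    simpa [mul_div_cancel_left₀ _ hγ'.ne'] using this
  have h6 : Tendsto (fun n => (ρ' n)⁻¹ • m' n - ρ⁻¹ • m) atTop (𝓝 0) := by
    rw [tendsto_zero_iff_norm_tendsto_zero]
    have h7 : Tendsto (fun n => ‖(ρ' n)⁻¹ • m' n - ρ⁻¹ • m‖ ^ 2) atTop (𝓝 0) := by
      have h8 := hR.div_const (ρ / 4)
      rw [zero_div] at h8
      refine tendsto_of_tendsto_of_tendsto_of_le_of_le' tendsto_const_nhds h8
        (Eventually.of_forall fun _ => sq_nonneg _) ?_
      filter_upwards [hpos] with n hn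
      rw [le_div_iff₀ (by positivity)]
      refine le_trans ?_ (relativeEnergy_ge_velocity hγ hρ (by linarith) m (m' n) S (S' n))
      rw [mul_comm]
      exact mul_le_mul_of_nonneg_right (by linarith) (sq_nonneg _)
    have := h7.sqrt
    simpa [Real.sqrt_sq] using this
  refine ⟨h2, ?_, ?_⟩
  · have h7 := h2.smul (h6.add_const (ρ⁻¹ • m))
    simp only [sub_add_cancel, zero_add, smul_inv_smul₀ hρ.ne'] at h7
    refine h7.congr' ?_
    filter_upwards [hpos] with n hn
    rw [smul_inv_smul₀]
    linarith
  · have h7 := h2.mul h5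
    rw [mul_div_cancel₀ _ hρ.ne'] at h7
    refine h7.congr' ?_
    filter_upwards [hpos] with n hn
    rw [mul_div_cancel₀]
    linarith

end Energy

/-! ### Convergence of integrals on exhausting sets -/

section Abstract

variable {X : Type*} [MeasurableSpace X] {μ : Measure X} [IsFiniteMeasure μ]

omit [IsFiniteMeasure μ] in
lemma IsBitingLimit.congr_limit {F : Type*} [NormedAddCommGroup F] [NormedSpace ℝ F]
    {f : ℕ → X → F} {g g' : X → F} (h : IsBitingLimit μ f g) (hg : g =ᵐ[μ] g') :
    IsBitingLimit μ f g' := by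
  obtain ⟨h1, h2, B, hB, hBa, hB0, hw⟩ := h
  refine ⟨h1, h2.congr hg, B, hB, hBa, hB0, fun k w hwm hwb => ?_⟩
  have : ∫ x in (B k)ᶜ, w x • g x ∂μ = ∫ x in (B k)ᶜ, w x • g' x ∂μ :=
    integral_congr_ae ((ae_restrict_of_ae hg).mono fun x hx => congrArg (w x • ·) hx)
  rw [← this]
  exact hw k w hwm hwb

omit [IsFiniteMeasure μ] in
/-- Weak convergence off a biting set, tested with coefficients that are bounded on a subset. -/
lemma tendsto_setIntegral_mul_clm_sub {F : Type*} [NormedAddCommGroup F] [NormedSpace ℝ F]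
    [CompleteSpace F] {f : ℕ → X → F} {g : X → F} (hf : ∀ n, Integrable (f n) μ)
    (hg : Integrable g μ) {B : Set X}
    (hw : ∀ w : X → ℝ, Measurable w → (∃ C : ℝ, ∀ x, |w x| ≤ C) →
      Tendsto (fun n => ∫ x in Bᶜ, w x • f n x ∂μ) atTop (𝓝 (∫ x in Bᶜ, w x • g x ∂μ)))
    {A : Set X} (hA : MeasurableSet A) (hAB : A ⊆ Bᶜ) {w : X → ℝ} (hwm : Measurable w)
    {C : ℝ} (hC : ∀ x ∈ A, |w x| ≤ C) (hC0 : 0 ≤ C) (L : F →L[ℝ] ℝ) :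
    (∀ n, IntegrableOn (fun x => w x * L (f n x - g x)) A μ) ∧
      Tendsto (fun n => ∫ x in A, w x * L (f n x - g x) ∂μ) atTop (𝓝 0) := by
  have hb : ∀ x, |A.indicator w x| ≤ C := fun x => by
    by_cases hx : x ∈ A <;> simp [hx, hC, hC0]
  have him := hwm.indicator hA
  -- The coefficient is bounded only on `A`, so the test function is its product with the indicator
  -- of `A`.
  have e : ∀ h : X → F, Integrable h μ →
      IntegrableOn (fun x => w x * L (h x)) A μ ∧
      ∫ x in A, w x * L (h x) ∂μ = L (∫ x in Bᶜ, A.indicator w x • h x ∂μ) := fun h hh => by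
    have hi : Integrable (fun x => A.indicator w x • h x) μ :=
      hh.bdd_smul (φ := A.indicator w) C him.aestronglyMeasurable (ae_of_all _ hb)
    have e1 : (fun x => L (A.indicator w x • h x)) = A.indicator fun x => w x * L (h x) := by
      ext x
      by_cases hx : x ∈ A <;> simp [hx]
    constructor
    · rw [← integrable_indicator_iff hA, ← e1]
      exact L.integrable_comp hi
    · rw [← L.integral_comp_comm hi.restrict, e1, setIntegral_indicator hA,
        inter_eq_self_of_subset_right hAB]
  have e2 : ∀ n x, w x * L (f n x - g x) = w x * L (f n x) - w x * L (g x) := fun n x => by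
    rw [map_sub, mul_sub]
  simp only [e2]
  refine ⟨fun n => (e _ (hf n)).1.sub (e _ hg).1, ?_⟩
  have h1 : ∀ n, ∫ x in A, (w x * L (f n x) - w x * L (g x)) ∂μ
      = L (∫ x in Bᶜ, A.indicator w x • f n x ∂μ) - L (∫ x in Bᶜ, A.indicator w x • g x ∂μ) :=
    fun n => by
      rw [integral_sub (e _ (hf n)).1 (e _ hg).1, (e _ (hf n)).2, (e _ hg).2]
  simp only [h1]
  rw [← sub_self (L (∫ x in Bᶜ, A.indicator w x • g x ∂μ))]
  exact ((L.continuous.tendsto _).comp (hw _ him ⟨C, hb⟩)).sub_const _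

omit [IsFiniteMeasure μ] in
/-- If the total energies do not exceed the limit energy in the limit, and the linear parts vanish
on an exhausting family of sets, then the relative energies vanish on these sets. -/
lemma tendsto_setIntegral_relative {E R ℓ : ℕ → X → ℝ} {E₀ : X → ℝ} {e : ℕ → ℝ}
    (hE : ∀ n, Integrable (E n) μ) (hE₀ : Integrable E₀ μ) (hEpos : ∀ n x, 0 ≤ E n x)
    (hR : ∀ n x, R n x = E n x - E₀ x - ℓ n x) (hRpos : ∀ n, ∀ᵐ x ∂μ, 0 ≤ R n x)
    (hle : ∀ n, ∫ x, E n x ∂μ ≤ ∫ x, E₀ x ∂μ + e n) (he : Tendsto e atTop (𝓝 0))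
    {A : ℕ → Set X} (hA : ∀ l, MeasurableSet (A l)) (hAm : Monotone A)
    (hA0 : Tendsto (fun l => μ (A l)ᶜ) atTop (𝓝 0)) (hℓ : ∀ l n, IntegrableOn (ℓ n) (A l) μ)
    (hℓ0 : ∀ l, Tendsto (fun n => ∫ x in A l, ℓ n x ∂μ) atTop (𝓝 0)) (l : ℕ) :
    (∀ n, IntegrableOn (R n) (A l) μ) ∧
      Tendsto (fun n => ∫ x in A l, R n x ∂μ) atTop (𝓝 0) := by
  have hRi : ∀ l n, IntegrableOn (R n) (A l) μ := fun l n => by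
    have : R n = fun x => E n x - E₀ x - ℓ n x := funext (hR n)
    rw [this]
    exact ((hE n).integrableOn.sub hE₀.integrableOn).sub (hℓ l n)
  refine ⟨hRi l, ?_⟩
  have hnn : ∀ l n, 0 ≤ ∫ x in A l, R n x ∂μ := fun l n =>
    integral_nonneg_of_ae (ae_restrict_of_ae (hRpos n))
  rw [Metric.tendsto_nhds]
  intro ε hε
  have h1 : Tendsto (fun j => ∫ x in (A j)ᶜ, E₀ x ∂μ) atTop (𝓝 0) :=
    hE₀.tendsto_setIntegral_nhds_zero hA0
  -- The energies are compared on the whole space but the linear part is controlled only on `A j`.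
  -- Dropping `E n` off `A j` costs nothing, so the integral of `R n` over `A j` is at most `e n`
  -- plus the limit energy off `A j` minus the linear part. A large `j ≥ l` makes the middle term
  -- small.
  obtain ⟨j, hj, hlj⟩ := ((h1.eventually_lt_const (half_pos hε)).and (eventually_ge_atTop l)).exists
  have h2 : Tendsto (fun n => e n - ∫ x in A j, ℓ n x ∂μ) atTop (𝓝 0) := by
    simpa using he.sub (hℓ0 j)
  filter_upwards [h2.eventually_lt_const (half_pos hε)] with n hn
  rw [Real.dist_0_eq_abs, abs_of_nonneg (hnn l n)]
  have h3 : ∫ x in A l, R n x ∂μ ≤ ∫ x in A j, R n x ∂μ :=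
    setIntegral_mono_set (hRi j n) (ae_restrict_of_ae (hRpos n)) (hAm hlj).eventuallyLE
  have h4 : ∫ x in A j, R n x ∂μ = (∫ x in A j, E n x ∂μ) - (∫ x in A j, E₀ x ∂μ)
      - ∫ x in A j, ℓ n x ∂μ := by
    simp only [hR]
    rw [integral_sub (f := fun x => E n x - E₀ x)
      ((hE n).integrableOn.sub hE₀.integrableOn) (hℓ j n),
      integral_sub (hE n).integrableOn hE₀.integrableOn]
  have h5 : ∫ x in A j, E n x ∂μ ≤ ∫ x, E n x ∂μ :=
    setIntegral_le_integral (hE n) (ae_of_all _ (hEpos n))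
  have h6 := integral_add_compl (hA j) hE₀
  have h7 := hle n
  linarith

/-- Nonnegative functions whose integrals vanish on an exhausting family of sets have a
subsequence that converges to zero almost everywhere. -/
lemma exists_subseq_tendsto_ae_zero {G : ℕ → X → ℝ} (hG : ∀ n, ∀ᵐ x ∂μ, 0 ≤ G n x)
    {A : ℕ → Set X} (hA0 : Tendsto (fun l => μ (A l)ᶜ) atTop (𝓝 0))
    (hGi : ∀ l n, IntegrableOn (G n) (A l) μ)
    (hG0 : ∀ l, Tendsto (fun n => ∫ x in A l, G n x ∂μ) atTop (𝓝 0)) :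
    ∃ σ : ℕ → ℕ, StrictMono σ ∧ ∀ᵐ x ∂μ, Tendsto (fun n => G (σ n) x) atTop (𝓝 0) := by
  refine TendstoInMeasure.exists_seq_tendsto_ae (g := fun _ => (0 : ℝ)) ?_
  rw [tendstoInMeasure_iff_measureReal_norm]
  intro ε hε
  rw [Metric.tendsto_nhds]
  intro δ hδ
  have hA0' : Tendsto (fun l => μ.real (A l)ᶜ) atTop (𝓝 0) := by
    simpa [Function.comp_def, Measure.real] using
      (ENNReal.tendsto_toReal ENNReal.zero_ne_top).comp hA0
  obtain ⟨l, hl⟩ := (hA0'.eventually_lt_const (half_pos hδ)).exists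
  have h1 : Tendsto (fun n => (∫ x in A l, G n x ∂μ) / ε) atTop (𝓝 0) := by
    simpa using (hG0 l).div_const ε
  filter_upwards [h1.eventually_lt_const (half_pos hδ)] with n hn
  rw [Real.dist_0_eq_abs, abs_of_nonneg measureReal_nonneg]
  have h2 : μ.real {x | ε ≤ ‖G n x - 0‖} ≤
      -- Off `A l` the measure is small outright; on `A l` Chebyshev's inequality applies.
      μ.real ({x | ε ≤ G n x} ∩ A l) + μ.real (A l)ᶜ := by
    refine le_trans ?_ (measureReal_union_le _ _)
    refine ENNReal.toReal_mono (measure_ne_top _ _) (measure_mono_ae ?_)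
    filter_upwards [hG n] with x hx hxm
    by_cases hxA : x ∈ A l
    · left
      refine ⟨?_, hxA⟩
      have : ε ≤ ‖G n x - 0‖ := hxm
      rwa [sub_zero, Real.norm_of_nonneg hx] at this
    · exact Or.inr hxA
  have h3 : μ.real ({x | ε ≤ G n x} ∩ A l) ≤ (∫ x in A l, G n x ∂μ) / ε := by
    rw [le_div_iff₀ hε, mul_comm]
    have h4 := mul_meas_ge_le_integral_of_nonneg (ae_restrict_of_ae (hG n)) (hGi l n) ε
    refine le_trans (mul_le_mul_of_nonneg_left ?_ hε.le) h4
    exact ENNReal.toReal_mono (measure_ne_top _ _) (Measure.le_restrict_apply _ _)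
  linarith

omit [IsFiniteMeasure μ] in
/-- A sequence with vanishing mean whose positive part vanishes in `L¹` vanishes in `L¹`. -/
lemma tendsto_setIntegral_abs_of_le {V : Set X} {f : ℕ → X → ℝ}
    (hf : ∀ n, IntegrableOn (f n) V μ)
    (hf0 : Tendsto (fun n => ∫ x in V, f n x ∂μ) atTop (𝓝 0))
    (hb : ∀ ε > 0, ∃ b : ℕ → X → ℝ, (∀ n, IntegrableOn (b n) V μ) ∧
      (∀ n, ∀ᵐ x ∂μ.restrict V, f n x ≤ b n x ∧ 0 ≤ b n x) ∧
      ∃ c, c < ε ∧ Tendsto (fun n => ∫ x in V, b n x ∂μ) atTop (𝓝 c)) :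
    Tendsto (fun n => ∫ x in V, |f n x| ∂μ) atTop (𝓝 0) := by
  rw [Metric.tendsto_nhds]
  intro ε hε
  obtain ⟨b, hbi, hfb, c, hc, hbc⟩ := hb (ε / 2) (half_pos hε)
  -- From `f ≤ b` and `0 ≤ b` follows `|f| ≤ 2b - f`, and the mean of `f` vanishes; this is why `b`
  -- is chosen for `ε / 2`.
  have h1 : Tendsto (fun n => 2 * (∫ x in V, b n x ∂μ) - ∫ x in V, f n x ∂μ) atTop
      (𝓝 (2 * c - 0)) := (hbc.const_mul 2).sub hf0
  filter_upwards [h1.eventually_lt_const (show 2 * c - 0 < ε by linarith)] with n hn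
  rw [Real.dist_0_eq_abs, abs_of_nonneg (integral_nonneg fun _ => abs_nonneg _)]
  refine lt_of_le_of_lt ?_ hn
  rw [← integral_const_mul, ← integral_sub ((hbi n).const_mul 2) (hf n)]
  refine integral_mono_ae (hf n).abs (((hbi n).const_mul 2).sub (hf n)) ?_
  filter_upwards [hfb n] with x ⟨h1, h2⟩
  show |f n x| ≤ 2 * b n x - f n x
  rcases abs_cases (f n x) with h | h <;> linarith

end Abstract

/-! ### From biting limits to a.e. convergence of states -/

section Convergence

variable {X : Type*} [MeasurableSpace X] {μ : Measure X} [IsFiniteMeasure μ] {d : ℕ} {γ : ℝ}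

lemma measurable_gradDensity {r : X → ℝ} {q : X → Space d} {s : X → ℝ} (hr : Measurable r)
    (hq : Measurable q) (hs : Measurable s) :
    Measurable fun x => gradDensity γ (r x) (q x) (s x) := by
  unfold gradDensity temperature
  refine Measurable.ite (measurableSet_lt measurable_const hr) ?_ measurable_const
  fun_prop

lemma measurable_gradMomentum {r : X → ℝ} {q : X → Space d} (hr : Measurable r)
    (hq : Measurable q) : Measurable fun x => gradMomentum (r x) (q x) := by
  unfold gradMomentum
  refine Measurable.ite (measurableSet_lt measurable_const hr) ?_ measurable_const
  fun_prop

lemma measurable_gradEntropy {r s : X → ℝ} (hr : Measurable r) (hs : Measurable s) :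
    Measurable fun x => gradEntropy γ (r x) (s x) := by
  unfold gradEntropy temperature
  refine Measurable.ite (measurableSet_lt measurable_const hr) ?_ measurable_const
  fun_prop

/-- The sublevel sets of a measurable function exhaust a finite measure space. -/
lemma tendsto_measure_superlevel_zero {D : X → ℝ} (hD : Measurable D) :
    Tendsto (fun l : ℕ => μ {x | (l : ℝ) < D x}) atTop (𝓝 0) := by
  have h : ⋂ l : ℕ, {x | (l : ℝ) < D x} = ∅ := by
    ext x
    simp only [mem_iInter, mem_ofPred_eq, mem_empty_iff_false, iff_false, not_forall, not_lt]
    exact exists_nat_ge (D x)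
  rw [← measure_empty (μ := μ), ← h]
  refine tendsto_measure_iInter_atTop
    (fun l => (measurableSet_lt measurable_const hD).nullMeasurableSet) ?_ ⟨0, measure_ne_top _ _⟩
  intro l k hlk x (hx : (k : ℝ) < D x)
  have : (l : ℝ) ≤ k := by exact_mod_cast hlk
  exact this.trans_lt hx

omit [IsFiniteMeasure μ] in
lemma integrable_totalEnergy_toReal {ρ : X → ℝ} {m : X → Space d} {S : X → ℝ}
    (hm : AEStronglyMeasurable (fun x => (ρ x, m x, S x)) μ)
    (h : ∫⁻ x, totalEnergy γ (ρ x) (m x) (S x) ∂μ ≠ ⊤) :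
    Integrable (fun x => (totalEnergy γ (ρ x) (m x) (S x)).toReal) μ ∧
      (∀ᵐ x ∂μ, totalEnergy γ (ρ x) (m x) (S x) ≠ ⊤) ∧
      ∫ x, (totalEnergy γ (ρ x) (m x) (S x)).toReal ∂μ =
        (∫⁻ x, totalEnergy γ (ρ x) (m x) (S x) ∂μ).toReal := by
  have h1 : AEMeasurable (fun x => totalEnergy γ (ρ x) (m x) (S x)) μ :=
    (measurable_totalEnergy (γ := γ)).comp_aemeasurable hm.aemeasurable
  refine ⟨integrable_toReal_of_lintegral_ne_top h1 h, ?_,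
    integral_toReal h1 (ae_lt_top' h1 h)⟩
  filter_upwards [ae_lt_top' h1 h] with x hx using hx.ne

omit [IsFiniteMeasure μ] in
/-- The linear part of the energy is weakly continuous on sets where its coefficients are bounded
and off a biting set. -/
lemma tendsto_setIntegral_energyDeriv {ρ : ℕ → X → ℝ} {m : ℕ → X → Space d} {S : ℕ → X → ℝ}
    {r : X → ℝ} {q : X → Space d} {s : X → ℝ} (hr : Measurable r) (hq : Measurable q)
    (hs : Measurable s) (hf : ∀ n, Integrable (fun x => (ρ n x, m n x, S n x)) μ)
    (hg : Integrable (fun x => (r x, q x, s x)) μ) {B : Set X}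
    (hw : ∀ w : X → ℝ, Measurable w → (∃ C : ℝ, ∀ x, |w x| ≤ C) →
      Tendsto (fun n => ∫ x in Bᶜ, w x • (ρ n x, m n x, S n x) ∂μ) atTop
        (𝓝 (∫ x in Bᶜ, w x • (r x, q x, s x) ∂μ)))
    {A : Set X} (hA : MeasurableSet A) (hAB : A ⊆ Bᶜ) {C : ℝ} (hC0 : 0 ≤ C)
    (h1 : ∀ x ∈ A, |gradDensity γ (r x) (q x) (s x)| ≤ C)
    (h2 : ∀ x ∈ A, ‖gradMomentum (r x) (q x)‖ ≤ C)
    (h3 : ∀ x ∈ A, |gradEntropy γ (r x) (s x)| ≤ C) :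
    (∀ n, IntegrableOn (fun x => energyDeriv γ (r x) (q x) (s x) (ρ n x - r x) (m n x - q x)
      (S n x - s x)) A μ) ∧
    Tendsto (fun n => ∫ x in A, energyDeriv γ (r x) (q x) (s x) (ρ n x - r x) (m n x - q x)
      (S n x - s x) ∂μ) atTop (𝓝 0) := by
  let Lρ : ℝ × Space d × ℝ →L[ℝ] ℝ := ContinuousLinearMap.fst ℝ ℝ (Space d × ℝ)
  let Lm : Fin d → ℝ × Space d × ℝ →L[ℝ] ℝ := fun i => (EuclideanSpace.proj i).comp
    ((ContinuousLinearMap.fst ℝ (Space d) ℝ).comp (ContinuousLinearMap.snd ℝ ℝ (Space d × ℝ)))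
  let LS : ℝ × Space d × ℝ →L[ℝ] ℝ :=
    (ContinuousLinearMap.snd ℝ (Space d) ℝ).comp (ContinuousLinearMap.snd ℝ ℝ (Space d × ℝ))
  have hqm := measurable_gradMomentum hr hq
  have a1 := tendsto_setIntegral_mul_clm_sub hf hg hw hA hAB (measurable_gradDensity hr hq hs) h1
    hC0 Lρ
  have a2 := fun i => tendsto_setIntegral_mul_clm_sub hf hg hw hA hAB
    (w := fun x => gradMomentum (r x) (q x) i) (by fun_prop)
    (fun x hx => (PiLp.norm_apply_le (gradMomentum (r x) (q x)) i).trans (h2 x hx)) hC0 (Lm i)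
  have a3 := tendsto_setIntegral_mul_clm_sub hf hg hw hA hAB (measurable_gradEntropy hr hs) h3
    hC0 LS
  have e : ∀ n x, energyDeriv γ (r x) (q x) (s x) (ρ n x - r x) (m n x - q x) (S n x - s x) =
      (gradDensity γ (r x) (q x) (s x) * Lρ ((ρ n x, m n x, S n x) - (r x, q x, s x))
      + ∑ i, gradMomentum (r x) (q x) i * Lm i ((ρ n x, m n x, S n x) - (r x, q x, s x)))
      + gradEntropy γ (r x) (s x) * LS ((ρ n x, m n x, S n x) - (r x, q x, s x)) := by
    intro n x
    simp only [energyDeriv, Lρ, Lm, LS, PiLp.inner_apply]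
    simp [mul_comm]
  simp only [e]
  have i2 : ∀ n, IntegrableOn (fun x => ∑ i, gradMomentum (r x) (q x) i *
      Lm i ((ρ n x, m n x, S n x) - (r x, q x, s x))) A μ := fun n =>
    integrable_finsetSum _ fun i _ => (a2 i).1 n
  refine ⟨fun n => ((a1.1 n).add (i2 n)).add (a3.1 n), ?_⟩
  have hsum := tendsto_finsetSum (Finset.univ : Finset (Fin d)) fun i _ => (a2 i).2
  have := (a1.2.add hsum).add a3.2
  simp only [Finset.sum_const_zero, add_zero] at this
  refine this.congr fun n => ?_
  have e1 := integral_add ((a1.1 n).add (i2 n)) (a3.1 n)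
  have e2 := integral_add (a1.1 n) (i2 n)
  rw [integral_finsetSum _ fun i _ => (a2 i).1 n] at e2
  rw [← e2]
  exact e1.symm

/-- On a set of vacuum states, weak convergence of density and entropy and vanishing energy give
strong convergence. -/
lemma tendsto_setIntegral_vacuum (hγ : 1 < γ) {ρ : ℕ → X → ℝ} {m : ℕ → X → Space d}
    {S : ℕ → X → ℝ} {V : Set X} (hρ : ∀ n, IntegrableOn (ρ n) V μ)
    (hS : ∀ n, IntegrableOn (S n) V μ)
    (hE : ∀ n, IntegrableOn (fun x => (totalEnergy γ (ρ n x) (m n x) (S n x)).toReal) V μ)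
    (hfin : ∀ n, ∀ᵐ x ∂μ, totalEnergy γ (ρ n x) (m n x) (S n x) ≠ ⊤)
    (hρ0 : Tendsto (fun n => ∫ x in V, ρ n x ∂μ) atTop (𝓝 0))
    (hS0 : Tendsto (fun n => ∫ x in V, S n x ∂μ) atTop (𝓝 0))
    (hE0 : Tendsto (fun n => ∫ x in V, (totalEnergy γ (ρ n x) (m n x) (S n x)).toReal ∂μ) atTop
      (𝓝 0)) :
    Tendsto (fun n => ∫ x in V, (ρ n x + |S n x|) ∂μ) atTop (𝓝 0) := by
  have hS1 : Tendsto (fun n => ∫ x in V, |S n x| ∂μ) atTop (𝓝 0) := by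
    refine tendsto_setIntegral_abs_of_le hS hS0 fun ε hε => ?_
    -- The constant in `entropy_le` integrates to `δ * μ.real V < ε`; the other terms of the bound
    -- tend to zero. The `+ 1` covers null sets.
    set δ := ε / (2 * (μ.real V + 1)) with hδ
    have hμ : 0 ≤ μ.real V := measureReal_nonneg
    have hδ0 : 0 < δ := by positivity
    have hi : ∀ n, IntegrableOn (fun x => δ + ρ n x * |Real.log δ|) V μ := fun n =>
      (integrable_const δ).add ((hρ n).mul_const _)
    refine ⟨fun n x => (totalEnergy γ (ρ n x) (m n x) (S n x)).toReal / (γ - 1)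
      + (δ + ρ n x * |Real.log δ|), fun n => ((hE n).div_const _).add (hi n), fun n => ?_,
      μ.real V * δ, ?_, ?_⟩
    · filter_upwards [ae_restrict_of_ae (hfin n)] with x hx
      refine ⟨entropy_le hγ hx hδ0, ?_⟩
      have h1 := density_nonneg_of_totalEnergy_ne_top hx
      have h2 : 0 < γ - 1 := sub_pos.mpr hγ
      positivity
    · have h1 : δ * (2 * (μ.real V + 1)) = ε := by
        rw [hδ]
        field_simp
      nlinarith
    · have h1 := (hE0.div_const (γ - 1)).add
        ((tendsto_const_nhds (x := μ.real V * δ)).add (hρ0.mul_const |Real.log δ|))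
      simp only [zero_div, zero_mul, zero_add, add_zero] at h1
      refine h1.congr fun n => ?_
      rw [integral_add ((hE n).div_const _) (hi n), integral_add (integrable_const δ)
        ((hρ n).mul_const _), integral_div, integral_mul_const, setIntegral_const, smul_eq_mul]
  have := hρ0.add hS1
  rw [add_zero] at this
  refine this.congr fun n => ?_
  rw [integral_add (hρ n) (hS n).abs]

/-- At a vacuum state the relative energy is the energy itself, which with the density controls the
momentum but not the negative part of the entropy. The added term supplies the density and `|S|`. -/
lemma tendsto_of_relativeEnergy_add (hγ : 1 < γ) {r : ℝ} {q : Space d} {s : ℝ} {ρ : ℕ → ℝ}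
    {m : ℕ → Space d} {S : ℕ → ℝ} (hU : totalEnergy γ r q s ≠ ⊤) (hvac : r = 0 → s = 0)
    (hE : ∀ n, totalEnergy γ (ρ n) (m n) (S n) ≠ ⊤)
    (h : Tendsto (fun n => relativeEnergy γ r q s (ρ n) (m n) (S n)
      + if r = 0 then ρ n + |S n| else 0) atTop (𝓝 0)) :
    Tendsto ρ atTop (𝓝 r) ∧ Tendsto m atTop (𝓝 q) ∧ Tendsto S atTop (𝓝 s) := by
  rcases totalEnergy_ne_top_cases hU with hr | ⟨rfl, rfl, -, -⟩
  · simp only [hr.ne', if_false, add_zero] at h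
    exact tendsto_of_relativeEnergy hγ hr hE h
  · obtain rfl := hvac rfl
    simp only [if_true, relativeEnergy_at_vacuum hU] at h
    have hρ := fun n => density_nonneg_of_totalEnergy_ne_top (hE n)
    have hp : ∀ n, 0 ≤ (totalEnergy γ (ρ n) (m n) (S n)).toReal := fun n => ENNReal.toReal_nonneg
    have hρ0 : Tendsto ρ atTop (𝓝 0) :=
      squeeze_zero hρ (fun n => by linarith [hp n, abs_nonneg (S n)]) h
    refine ⟨hρ0, ?_, ?_⟩
    · refine squeeze_zero_norm (fun n => ?_) h
      linarith [norm_momentum_le (hE n), abs_nonneg (S n), hρ n]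
    · refine squeeze_zero_norm (fun n => ?_) h
      rw [Real.norm_eq_abs]
      linarith [hp n, hρ n]

/-- If a sequence of states has a biting limit whose energy is not exceeded in the limit, a
subsequence converges almost everywhere, for measurable representatives of the limit. -/
lemma exists_subseq_tendsto_ae_of_measurable (hγ : 1 < γ) {ρ : ℕ → X → ℝ} {m : ℕ → X → Space d}
    {S : ℕ → X → ℝ} {r : X → ℝ} {q : X → Space d} {s : X → ℝ} (hr : Measurable r)
    (hq : Measurable q) (hs : Measurable s)
    (hlim : IsBitingLimit μ (fun n x => (ρ n x, m n x, S n x)) (fun x => (r x, q x, s x)))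
    (hE : ∫⁻ x, totalEnergy γ (r x) (q x) (s x) ∂μ ≠ ⊤) {e : ℕ → ℝ≥0}
    (he : Tendsto e atTop (𝓝 0))
    (hEn : ∀ n, ∫⁻ x, totalEnergy γ (ρ n x) (m n x) (S n x) ∂μ ≤
      ∫⁻ x, totalEnergy γ (r x) (q x) (s x) ∂μ + e n)
    (hvac : ∀ᵐ x ∂μ, r x = 0 → s x = 0) :
    ∃ σ : ℕ → ℕ, StrictMono σ ∧ ∀ᵐ x ∂μ, Tendsto (fun n => ρ (σ n) x) atTop (𝓝 (r x)) ∧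
      Tendsto (fun n => m (σ n) x) atTop (𝓝 (q x)) ∧
      Tendsto (fun n => S (σ n) x) atTop (𝓝 (s x)) := by
  obtain ⟨hf, hg, B, hB, hBa, hB0, hw⟩ := hlim
  have hEn' : ∀ n, ∫⁻ x, totalEnergy γ (ρ n x) (m n x) (S n x) ∂μ ≠ ⊤ := fun n =>
    ne_top_of_le_ne_top (ENNReal.add_ne_top.mpr ⟨hE, ENNReal.coe_ne_top⟩) (hEn n)
  obtain ⟨hE₀i, hUfin, hE₀eq⟩ := integrable_totalEnergy_toReal (γ := γ) hg.1 hE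
  have hEi := fun n => (integrable_totalEnergy_toReal (γ := γ) (hf n).1 (hEn' n)).1
  have hfin := fun n => (integrable_totalEnergy_toReal (γ := γ) (hf n).1 (hEn' n)).2.1
  have m1 := measurable_gradDensity (γ := γ) hr hq hs
  have m2 := measurable_gradMomentum hr hq
  have m3 := measurable_gradEntropy (γ := γ) hr hs
  set D : X → ℝ := fun x => |gradDensity γ (r x) (q x) (s x)| + ‖gradMomentum (r x) (q x)‖
    + |gradEntropy γ (r x) (s x)| with hD
  have hDm : Measurable D := by
    have := m1.norm
    have := m2.norm
    have := m3.norm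
    simp only [Real.norm_eq_abs] at *
    exact (Measurable.add (by assumption) (by assumption)).add (by assumption)
  -- Off the bite the convergence is weak in `L¹`, and `D ≤ l` makes the coefficients of the linear
  -- part admissible as test functions.
  set A : ℕ → Set X := fun l => (B l)ᶜ ∩ {x | D x ≤ l} with hAdef
  have hA : ∀ l, MeasurableSet (A l) := fun l =>
    (hB l).compl.inter (measurableSet_le hDm measurable_const)
  have hAm : Monotone A := fun l k hlk => by
    refine inter_subset_inter (compl_subset_compl.mpr (hBa hlk)) fun x (hx : D x ≤ l) => ?_
    have : (l : ℝ) ≤ k := by exact_mod_cast hlk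
    exact hx.trans this
  have hA0 : Tendsto (fun l => μ (A l)ᶜ) atTop (𝓝 0) := by
    have h := hB0.add (tendsto_measure_superlevel_zero (μ := μ) hDm)
    rw [add_zero] at h
    refine tendsto_of_tendsto_of_tendsto_of_le_of_le tendsto_const_nhds h (fun _ => zero_le)
      fun l => ?_
    refine le_trans (measure_mono ?_) (measure_union_le _ _)
    intro x hx
    by_cases hxB : x ∈ B l
    · exact Or.inl hxB
    · exact Or.inr (show (l : ℝ) < D x from not_le.mp fun h => hx ⟨hxB, h⟩)
  have hD1 : ∀ x, |gradDensity γ (r x) (q x) (s x)| ≤ D x := fun x => by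
    have := norm_nonneg (gradMomentum (r x) (q x))
    have := abs_nonneg (gradEntropy γ (r x) (s x))
    simp only [hD]
    linarith
  have hD2 : ∀ x, ‖gradMomentum (r x) (q x)‖ ≤ D x := fun x => by
    have := abs_nonneg (gradDensity γ (r x) (q x) (s x))
    have := abs_nonneg (gradEntropy γ (r x) (s x))
    simp only [hD]
    linarith
  have hD3 : ∀ x, |gradEntropy γ (r x) (s x)| ≤ D x := fun x => by
    have := abs_nonneg (gradDensity γ (r x) (q x) (s x))
    have := norm_nonneg (gradMomentum (r x) (q x))
    simp only [hD]
    linarith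
  have hlin := fun l => tendsto_setIntegral_energyDeriv (γ := γ) hr hq hs hf hg (hw l) (hA l)
    inter_subset_left (Nat.cast_nonneg l) (fun x hx => (hD1 x).trans hx.2)
    (fun x hx => (hD2 x).trans hx.2) (fun x hx => (hD3 x).trans hx.2)
  have hRpos : ∀ n, ∀ᵐ x ∂μ, 0 ≤ relativeEnergy γ (r x) (q x) (s x) (ρ n x) (m n x) (S n x) :=
    fun n => by
      filter_upwards [hUfin, hfin n] with x h1 h2 using relativeEnergy_nonneg hγ h1 h2
  have hle : ∀ n, ∫ x, (totalEnergy γ (ρ n x) (m n x) (S n x)).toReal ∂μ ≤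
      ∫ x, (totalEnergy γ (r x) (q x) (s x)).toReal ∂μ + (e n : ℝ) := fun n => by
    rw [(integrable_totalEnergy_toReal (γ := γ) (hf n).1 (hEn' n)).2.2, hE₀eq,
      ← ENNReal.coe_toReal, ← ENNReal.toReal_add hE ENNReal.coe_ne_top]
    exact ENNReal.toReal_mono (ENNReal.add_ne_top.mpr ⟨hE, ENNReal.coe_ne_top⟩) (hEn n)
  have hrel := tendsto_setIntegral_relative (e := fun n => (e n : ℝ))
    (R := fun n x => relativeEnergy γ (r x) (q x) (s x) (ρ n x) (m n x) (S n x)) hEi hE₀i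
    (fun n x => ENNReal.toReal_nonneg) (fun n x => rfl) hRpos hle
    (by rw [← NNReal.coe_zero]; exact NNReal.tendsto_coe.mpr he) hA hAm
    hA0 (fun l => (hlin l).1) (fun l => (hlin l).2)
  have hr0 : MeasurableSet {x | r x = 0} := hr (measurableSet_singleton 0)
  have hVac : ∀ l, Tendsto (fun n => ∫ x in A l ∩ {x | r x = 0}, (ρ n x + |S n x|) ∂μ) atTop
      (𝓝 0) := by
    intro l
    have hV := (hA l).inter hr0
    have hVB : A l ∩ {x | r x = 0} ⊆ (B l)ᶜ := inter_subset_left.trans inter_subset_left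
    have hone : ∀ x ∈ A l ∩ {x | r x = 0}, |(fun _ : X => (1 : ℝ)) x| ≤ 1 := fun x _ => by simp
    have b1 := (tendsto_setIntegral_mul_clm_sub hf hg (hw l) hV hVB measurable_const hone
      zero_le_one (ContinuousLinearMap.fst ℝ ℝ (Space d × ℝ))).2
    have b3 := (tendsto_setIntegral_mul_clm_sub hf hg (hw l) hV hVB measurable_const hone
      zero_le_one ((ContinuousLinearMap.snd ℝ (Space d) ℝ).comp
        (ContinuousLinearMap.snd ℝ ℝ (Space d × ℝ)))).2
    refine tendsto_setIntegral_vacuum hγ (fun n => (hf n).fst.integrableOn)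
      (fun n => (hf n).snd.snd.integrableOn) (fun n => (hEi n).integrableOn) hfin ?_ ?_ ?_
    · refine b1.congr fun n => setIntegral_congr_fun hV fun x hx => ?_
      have : r x = 0 := hx.2
      simp [this]
    · refine b3.congr fun n => setIntegral_congr_ae hV ?_
      filter_upwards [hvac] with x hx hxV
      have : s x = 0 := hx hxV.2
      simp [this]
    -- On the vacuum of the limit the energy equals the relative energy, which already tends to zero
    -- in `L¹` of `A l`.
    · refine squeeze_zero (fun n => integral_nonneg fun x => ENNReal.toReal_nonneg) (fun n => ?_)
        (hrel l).2
      refine le_trans (le_of_eq ?_) (setIntegral_mono_set ((hrel l).1 n)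
        (ae_restrict_of_ae (hRpos n)) (inter_subset_left (t := {x | r x = 0})).eventuallyLE)
      refine setIntegral_congr_ae hV ?_
      filter_upwards [hUfin] with x hx hxV
      have h0 : r x = 0 := hxV.2
      rw [h0] at hx ⊢
      exact (relativeEnergy_at_vacuum hx _ _ _).symm
  have hif : ∀ n x, (if r x = 0 then ρ n x + |S n x| else 0)
      = {x | r x = 0}.indicator (fun x => ρ n x + |S n x|) x := fun n x => by
    simp [indicator]
  have hi2 : ∀ l n, IntegrableOn (fun x => if r x = 0 then ρ n x + |S n x| else 0) (A l) μ :=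
    fun l n => by
      simp only [hif]
      exact (((hf n).fst.add (hf n).snd.snd.abs).indicator hr0).integrableOn
  obtain ⟨σ, hσ, hσ0⟩ := exists_subseq_tendsto_ae_zero (μ := μ)
    (G := fun n x => relativeEnergy γ (r x) (q x) (s x) (ρ n x) (m n x) (S n x)
      + if r x = 0 then ρ n x + |S n x| else 0)
    (fun n => by
      filter_upwards [hRpos n, hfin n] with x h1 h2
      have h3 := density_nonneg_of_totalEnergy_ne_top h2
      split_ifs
      · positivity
      · simpa using h1) hA0 (fun l n => ((hrel l).1 n).add (hi2 l n)) (fun l => by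
      have h := (hrel l).2.add (hVac l)
      rw [add_zero] at h
      refine h.congr fun n => ?_
      rw [integral_add ((hrel l).1 n) (hi2 l n), ← setIntegral_indicator hr0]
      simp only [hif])
  refine ⟨σ, hσ, ?_⟩
  filter_upwards [hσ0, hUfin, hvac, ae_all_iff.mpr hfin] with x h1 h2 h3 h4
  exact tendsto_of_relativeEnergy_add hγ h2 h3 (fun n => h4 (σ n)) h1

/-- If a sequence of states has a biting limit whose energy is not exceeded in the limit, and the
entropy of the limit vanishes in the vacuum, a subsequence converges almost everywhere. -/
theorem IsBitingLimit.exists_subseq_tendsto_ae (hγ : 1 < γ) {ρ : ℕ → X → ℝ}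
    {m : ℕ → X → Space d} {S : ℕ → X → ℝ} {r : X → ℝ} {q : X → Space d} {s : X → ℝ}
    (hlim : IsBitingLimit μ (fun n x => (ρ n x, m n x, S n x)) (fun x => (r x, q x, s x)))
    (hE : ∫⁻ x, totalEnergy γ (r x) (q x) (s x) ∂μ ≠ ⊤) {e : ℕ → ℝ≥0}
    (he : Tendsto e atTop (𝓝 0))
    (hEn : ∀ n, ∫⁻ x, totalEnergy γ (ρ n x) (m n x) (S n x) ∂μ ≤
      ∫⁻ x, totalEnergy γ (r x) (q x) (s x) ∂μ + e n)
    (hvac : ∀ᵐ x ∂μ, r x = 0 → s x = 0) :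
    ∃ σ : ℕ → ℕ, StrictMono σ ∧ ∀ᵐ x ∂μ, Tendsto (fun n => ρ (σ n) x) atTop (𝓝 (r x)) ∧
      Tendsto (fun n => m (σ n) x) atTop (𝓝 (q x)) ∧
      Tendsto (fun n => S (σ n) x) atTop (𝓝 (s x)) := by
  have hgm := hlim.2.1.1
  set P := hgm.mk _ with hP
  have hPm : Measurable P := hgm.stronglyMeasurable_mk.measurable
  have hPe : (fun x => (r x, q x, s x)) =ᵐ[μ] P := hgm.ae_eq_mk
  have hEeq : ∫⁻ x, totalEnergy γ (r x) (q x) (s x) ∂μ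
      = ∫⁻ x, totalEnergy γ (P x).1 (P x).2.1 (P x).2.2 ∂μ :=
    lintegral_congr_ae (by filter_upwards [hPe] with x hx; rw [← hx])
  rw [hEeq] at hE hEn
  obtain ⟨σ, hσ, h⟩ := exists_subseq_tendsto_ae_of_measurable hγ hPm.fst hPm.snd.fst hPm.snd.snd
    (hlim.congr_limit hPe) hE he hEn (by
      filter_upwards [hPe, hvac] with x hx hv
      rw [← hx]
      exact hv)
  refine ⟨σ, hσ, ?_⟩
  filter_upwards [h, hPe] with x hx hxe
  rw [← hxe] at hx
  exact hx

end Convergence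

/-! ### Bounds on time slices under biting limits -/

section Slices

variable {α β : Type*} [MeasurableSpace α] [MeasurableSpace β] {μ : Measure α} {ν : Measure β}
  [IsFiniteMeasure μ] [IsFiniteMeasure ν]

lemma setLIntegral_prod_univ_le {f : α × β → ℝ≥0∞} (hf : AEMeasurable f (μ.prod ν)) {c : ℝ≥0∞}
    (hc : ∀ᵐ τ ∂μ, ∫⁻ x, f (τ, x) ∂ν ≤ c) (s : Set α) :
    ∫⁻ z in s ×ˢ univ, f z ∂(μ.prod ν) ≤ c * μ s := by
  have h : (μ.prod ν).restrict (s ×ˢ univ) = (μ.restrict s).prod ν := by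
    rw [← Measure.prod_restrict, Measure.restrict_univ]
  rw [h, lintegral_prod _ (by rw [← h]; exact hf.restrict)]
  refine (lintegral_mono_ae (ae_restrict_of_ae hc)).trans ?_
  rw [lintegral_const, Measure.restrict_apply_univ]

omit [IsFiniteMeasure μ] [IsFiniteMeasure ν] in
/-- A bound for weighted integrals passes to a biting limit. -/
lemma IsBitingLimit.setLIntegral_enorm_le {X : Type*} [MeasurableSpace X] {μ : Measure X}
    {f : ℕ → X → ℝ} {g : X → ℝ} (h : IsBitingLimit μ f g) {s : Set X} (hs : MeasurableSet s)
    {C : ℝ≥0} (hC : ∀ n, ∫⁻ x in s, ‖f n x‖ₑ ∂μ ≤ C) : ∫⁻ x in s, ‖g x‖ₑ ∂μ ≤ C := by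
  obtain ⟨hf, hg, B, hB, hBa, hB0, hw⟩ := h
  have hgm := hg.1.stronglyMeasurable_mk.measurable
  -- The sign of the limit on `s` is an admissible test function, so the bound passes off each bite.
  set w : X → ℝ := s.indicator fun x => if 0 ≤ hg.1.mk _ x then 1 else -1 with hwdef
  have hwm : Measurable w := (Measurable.ite (measurableSet_le measurable_const hgm)
    measurable_const measurable_const).indicator hs
  have hwb : ∀ x, |w x| ≤ s.indicator 1 x := fun x => by
    by_cases hx : x ∈ s
    · simp only [hwdef, hx, indicator_of_mem]
      split_ifs <;> simp
    · simp [hwdef, hx]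
  have hwg : ∀ᵐ x ∂μ, w x • g x = s.indicator (fun x => ‖g x‖) x := by
    filter_upwards [hg.1.ae_eq_mk] with x hx
    by_cases hxs : x ∈ s
    · simp only [hwdef, hxs, indicator_of_mem, ← hx, Real.norm_eq_abs, smul_eq_mul]
      split_ifs with h0
      · rw [one_mul, abs_of_nonneg h0]
      · rw [neg_one_mul, abs_of_neg (not_le.mp h0)]
    · simp [hwdef, hxs]
  have hone : ∀ x, s.indicator (1 : X → ℝ) x ≤ 1 := fun x => by
    by_cases hx : x ∈ s <;> simp [hx]
  have key : ∀ k, ∫⁻ x in s ∩ (B k)ᶜ, ‖g x‖ₑ ∂μ ≤ C := by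
    intro k
    have h1 : ∫ x in (B k)ᶜ, w x • g x ∂μ = ∫ x in s ∩ (B k)ᶜ, ‖g x‖ ∂μ := by
      rw [integral_congr_ae (ae_restrict_of_ae hwg), setIntegral_indicator hs, inter_comm]
    have h2 : ∫ x in s ∩ (B k)ᶜ, ‖g x‖ ∂μ ≤ C := by
      rw [← h1]
      refine le_of_tendsto' (hw k w hwm ⟨1, fun x => (hwb x).trans (hone x)⟩) fun n => ?_
      have h3 : ∫ x in s, ‖f n x‖ ∂μ ≤ C := by
        rw [integral_norm_eq_lintegral_enorm (hf n).1.restrict]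
        exact ENNReal.toReal_le_coe_of_le_coe (hC n)
      refine le_trans ?_ h3
      have hi : Integrable (s.indicator fun x => ‖f n x‖) μ := (hf n).norm.indicator hs
      refine (Real.le_norm_self _).trans ((norm_integral_le_of_norm_le hi.restrict
        (ae_of_all _ fun x => ?_)).trans ?_)
      · rw [norm_smul, Real.norm_eq_abs]
        refine (mul_le_mul_of_nonneg_right (hwb x) (norm_nonneg _)).trans (le_of_eq ?_)
        by_cases hx : x ∈ s <;> simp [hx]
      · refine (setIntegral_le_integral hi (ae_of_all _ fun x => ?_)).trans
          (integral_indicator hs).le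
        exact indicator_nonneg (fun _ _ => norm_nonneg _) x
    rw [← ofReal_integral_norm_eq_lintegral_enorm hg.integrableOn]
    exact (ENNReal.ofReal_le_ofReal h2).trans_eq (ENNReal.ofReal_coe_nnreal)
  -- The limit is integrable, so its integral over the bites vanishes and the bound extends to all
  -- of `s`.
  have h0 := tendsto_setLIntegral_zero (f := fun x => ‖g x‖ₑ) hg.2.ne hB0
  have h4 : Tendsto (fun k => (C : ℝ≥0∞) + ∫⁻ x in B k, ‖g x‖ₑ ∂μ) atTop (𝓝 (C + 0)) :=
    tendsto_const_nhds.add h0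
  rw [add_zero] at h4
  refine ge_of_tendsto' h4 fun k => ?_
  refine le_trans ?_ (add_le_add (key k) le_rfl)
  refine le_trans (lintegral_mono_set ?_) (lintegral_union_le _ _ _)
  intro x hx
  by_cases hxB : x ∈ B k
  · exact Or.inr hxB
  · exact Or.inl ⟨hx, hxB⟩

/-- A uniform bound of the `L¹` norms of slices passes to a biting limit. -/
lemma IsBitingLimit.ae_slice_le {f : ℕ → α × β → ℝ} {g : α × β → ℝ}
    (h : IsBitingLimit (μ.prod ν) f g) {c : ℝ≥0}
    (hc : ∀ n, ∀ᵐ τ ∂μ, ∫⁻ x, ‖f n (τ, x)‖ₑ ∂ν ≤ c) : ∀ᵐ τ ∂μ, ∫⁻ x, ‖g (τ, x)‖ₑ ∂ν ≤ c := by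
  have hgm : AEMeasurable (fun z => ‖g z‖ₑ) (μ.prod ν) := h.2.1.1.enorm
  -- A pointwise bound in time is equivalent to bounds over all time sets `s`, that is over the
  -- product sets `s ×ˢ univ`, where the biting limit can be tested.
  refine ae_le_of_forall_setLIntegral_le_of_sigmaFinite₀ (g := fun _ => (c : ℝ≥0∞))
    hgm.lintegral_prod_right' fun s hs _ => ?_
  have h1 : (μ.prod ν).restrict (s ×ˢ univ) = (μ.restrict s).prod ν := by
    rw [← Measure.prod_restrict, Measure.restrict_univ]
  rw [← lintegral_prod (fun z => ‖g z‖ₑ) (by rw [← h1]; exact hgm.restrict), ← h1, lintegral_const,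
    Measure.restrict_apply_univ]
  have h2 : (c : ℝ≥0∞) * μ s = ((c * (μ s).toNNReal : ℝ≥0) : ℝ≥0∞) := by
    rw [ENNReal.coe_mul, ENNReal.coe_toNNReal (measure_ne_top _ _)]
  rw [h2]
  refine h.setLIntegral_enorm_le (hs.prod MeasurableSet.univ) fun n => ?_
  rw [← h2]
  exact setLIntegral_prod_univ_le (h.1 n).1.enorm (hc n) s

end Slices

/-! ### `L¹` bounds from the energy -/

lemma EuclideanSpace.enorm_le_sum {d : ℕ} (v : Space d) : ‖v‖ₑ ≤ ∑ i, ‖v i‖ₑ := by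
  have h : v = ∑ i, v i • EuclideanSpace.single i (1 : ℝ) := by
    ext j
    simp [Finset.sum_apply, Pi.single_apply]
  nth_rw 1 [h]
  refine (enorm_sum_le _ _).trans (Finset.sum_le_sum fun i _ => ?_)
  simp [nnnorm_smul, enorm_eq_nnnorm]

lemma enorm_triple_le {E F G : Type*} [NormedAddCommGroup E] [NormedAddCommGroup F]
    [NormedAddCommGroup G] (a : E) (b : F) (c : G) : ‖(a, b, c)‖ₑ ≤ ‖a‖ₑ + ‖b‖ₑ + ‖c‖ₑ := by
  simp only [enorm_eq_nnnorm, ← ENNReal.coe_add, ENNReal.coe_le_coe, Prod.nnnorm_def]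
  refine sup_le ?_ (sup_le ?_ ?_)
  · rw [add_assoc]
    exact le_self_add
  · rw [add_comm ‖a‖₊, add_assoc]
    exact le_self_add
  · exact le_add_self

/-- The energy, the mass and a lower bound of the total entropy control the `L¹` norms. -/
lemma lintegral_enorm_le_of_energy {X : Type*} [MeasurableSpace X] {ν : Measure X}
    [IsFiniteMeasure ν] {d : ℕ} {γ : ℝ} (hγ : 1 < γ) {ρ : X → ℝ} {m : X → Space d} {S : X → ℝ}
    (hm : AEStronglyMeasurable m ν) {M Sinf : ℝ} {K : ℝ≥0} (hρ : Integrable ρ ν)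
    (hM : ∫ x, ρ x ∂ν ≤ M) (hS : Integrable S ν) (hSinf : Sinf ≤ ∫ x, S x ∂ν)
    (hK : ∫⁻ x, totalEnergy γ (ρ x) (m x) (S x) ∂ν ≤ K) :
    (∫⁻ x, ‖ρ x‖ₑ ∂ν) + (∫⁻ x, ‖m x‖ₑ ∂ν) + (∫⁻ x, ‖S x‖ₑ ∂ν) ≤
      ENNReal.ofReal M + ENNReal.ofReal (K + M / 2)
        + ENNReal.ofReal (2 * (K / (γ - 1) + ν.real univ) - Sinf) := by
  have hγ' : 0 < γ - 1 := sub_pos.mpr hγ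
  have htop := ne_top_of_le_ne_top ENNReal.coe_ne_top hK
  obtain ⟨hEi, hfin, hEeq⟩ := integrable_totalEnergy_toReal (γ := γ)
    (hρ.1.prodMk (hm.prodMk hS.1)) htop
  have hEK : ∫ x, (totalEnergy γ (ρ x) (m x) (S x)).toReal ∂ν ≤ K := by
    rw [hEeq]
    exact ENNReal.toReal_le_coe_of_le_coe hK
  have hmb : ∀ᵐ x ∂ν, ‖m x‖ ≤ (totalEnergy γ (ρ x) (m x) (S x)).toReal + ρ x / 2 := by
    filter_upwards [hfin] with x hx using norm_momentum_le hx
  have hmi : Integrable m ν := (hEi.add (hρ.div_const 2)).mono' hm hmb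
  refine add_le_add (add_le_add ?_ ?_) ?_
  · rw [← ofReal_integral_norm_eq_lintegral_enorm hρ]
    refine ENNReal.ofReal_le_ofReal (le_trans (le_of_eq (integral_congr_ae ?_)) hM)
    filter_upwards [hfin] with x hx
    exact Real.norm_of_nonneg (density_nonneg_of_totalEnergy_ne_top hx)
  · rw [← ofReal_integral_norm_eq_lintegral_enorm hmi]
    refine ENNReal.ofReal_le_ofReal ((integral_mono_ae hmi.norm (hEi.add (hρ.div_const 2))
      hmb).trans ?_)
    have h := integral_add hEi (hρ.div_const 2)
    rw [integral_div] at h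
    refine h.trans_le ?_
    linarith
  · rw [← ofReal_integral_norm_eq_lintegral_enorm hS]
    have hbi : Integrable (fun x => (totalEnergy γ (ρ x) (m x) (S x)).toReal / (γ - 1) + 1) ν :=
      (hEi.div_const _).add (integrable_const 1)
    refine ENNReal.ofReal_le_ofReal ((integral_mono_ae hS.norm ((hbi.const_mul 2).sub hS)
      ?_).trans ?_)
    · filter_upwards [hfin] with x hx
      -- The choice `ε = 1` removes the density term, since `log 1 = 0`. The resulting upper bound
      -- for `S`, together with the lower bound on its mean, controls `|S|`.
      have h1 := entropy_le hγ hx one_pos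
      simp only [Real.log_one, abs_zero, mul_zero, add_zero] at h1
      have h2 : 0 ≤ (totalEnergy γ (ρ x) (m x) (S x)).toReal / (γ - 1) :=
        div_nonneg ENNReal.toReal_nonneg hγ'.le
      show |S x| ≤ 2 * ((totalEnergy γ (ρ x) (m x) (S x)).toReal / (γ - 1) + 1) - S x
      rcases abs_cases (S x) with h | h <;> linarith
    · have h := integral_sub (hbi.const_mul 2) hS
      rw [integral_const_mul, integral_add (hEi.div_const _) (integrable_const 1), integral_div,
        integral_const, smul_eq_mul, mul_one] at h
      refine h.trans_le ?_
      have h3 := div_le_div_of_nonneg_right hEK hγ'.le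
      linarith

/-! ### Conservation of energy -/

/-- A test function that equals one near all points of `[0, τ] × Ω`. -/
lemma exists_testFunction_eventuallyEq_one {d : ℕ} {T τ : ℝ} (hτ : τ ∈ Ico 0 T) {Ω : Set (Space d)}
    (hΩ : Bornology.IsBounded Ω) :
    ∃ (χ : ℝ → ℝ) (ψ : Space d → ℝ), IsTestFunction T (fun z : ℝ × Space d => χ z.1 * ψ z.2) ∧
      (∀ t ∈ Icc 0 τ, χ =ᶠ[𝓝 t] 1) ∧ ∀ x ∈ Ω, ψ =ᶠ[𝓝 x] 1 := by
  obtain ⟨h0, hT⟩ := hτ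
  obtain ⟨R, hR, hΩR⟩ := hΩ.subset_ball_lt 0 0
  -- Centred at `τ / 2`, the inner ball contains `[0, τ]` with margin `(T - τ) / 4`, and the outer
  -- one ends at `(T + τ) / 2 < T`.
  let χ : ContDiffBump (τ / 2 : ℝ) := ⟨τ / 2 + (T - τ) / 4, τ / 2 + (T - τ) / 2, by linarith,
    by linarith⟩
  let ψ : ContDiffBump (0 : Space d) := ⟨R, R + 1, hR, by linarith⟩
  have hK : IsCompact (Metric.closedBall (τ / 2 : ℝ) χ.rOut ×ˢ
      Metric.closedBall (0 : Space d) ψ.rOut) :=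
    (isCompact_closedBall _ _).prod (isCompact_closedBall _ _)
  have hz : ∀ z ∉ Metric.closedBall (τ / 2 : ℝ) χ.rOut ×ˢ Metric.closedBall (0 : Space d) ψ.rOut,
      χ z.1 * ψ z.2 = 0 := by
    rintro ⟨t, x⟩ hz
    by_cases ht : t ∈ Metric.closedBall (τ / 2 : ℝ) χ.rOut
    · have hx : x ∉ Metric.closedBall (0 : Space d) ψ.rOut := fun hx => hz ⟨ht, hx⟩
      simp only [Metric.mem_closedBall, not_le] at hx
      rw [ψ.zero_of_le_dist hx.le, mul_zero]
    · simp only [Metric.mem_closedBall, not_le] at ht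
      rw [χ.zero_of_le_dist ht.le, zero_mul]
  refine ⟨χ, ψ, ⟨?_, HasCompactSupport.intro hK hz, ?_⟩, fun t ht => ?_, fun x hx => ?_⟩
  · exact (χ.contDiff.comp contDiff_fst).mul (ψ.contDiff.comp contDiff_snd)
  · refine (closure_minimal (fun z hzs => ?_) hK.isClosed).trans (prod_mono ?_ (subset_univ _))
    · by_contra h
      exact hzs (hz z h)
    · intro t ht
      rw [Metric.mem_closedBall, Real.dist_eq] at ht
      have := (abs_le.mp ht).2
      simp only [mem_Iio]
      simp only [χ] at this
      linarith
  · refine χ.eventuallyEq_one_of_mem_ball ?_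
    rw [Metric.mem_ball, Real.dist_eq, abs_lt]
    simp only [χ]
    constructor <;> linarith [ht.1, ht.2]
  · exact ψ.eventuallyEq_one_of_mem_ball (hΩR hx)

/-- Admissible weak solutions conserve the total energy. -/
lemma IsAdmissibleWeakSolution.lintegral_energy_eq {d : ℕ} {γ T : ℝ} {Ω : Set (Space d)}
    (hΩo : IsOpen Ω) (hΩb : Bornology.IsBounded Ω) {ρ₀ : Space d → ℝ} {m₀ : Space d → Space d}
    {S₀ : Space d → ℝ} {ρ : ℝ → Space d → ℝ} {m : ℝ → Space d → Space d} {S : ℝ → Space d → ℝ}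
    (h : IsAdmissibleWeakSolution γ T Ω ρ₀ m₀ S₀ ρ m S) {τ : ℝ} (hτ : τ ∈ Ico 0 T) :
    ∫⁻ x in Ω, totalEnergy γ (ρ τ x) (m τ x) (S τ x) =
      ∫⁻ x in Ω, totalEnergy γ (ρ₀ x) (m₀ x) (S₀ x) := by
  obtain ⟨χ, ψ, hφ, hχ, hψ⟩ := exists_testFunction_eventuallyEq_one hτ hΩb
  have hE := h.energy_eq _ hφ τ hτ
  have hχ1 : ∀ t ∈ Icc 0 τ, χ t = 1 := fun t ht => (hχ t ht).eq_of_nhds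
  have hψ1 : ∀ x ∈ Ω, ψ x = 1 := fun x hx => (hψ x hx).eq_of_nhds
  -- Both derivatives of the test function vanish on the domain of integration, so only the energies
  -- at times `τ` and `0` survive.
  have ht : ∀ t ∈ Ioo 0 τ, ∀ x, timeDeriv (fun z : ℝ × Space d => χ z.1 * ψ z.2) t x = 0 := by
    intro t ht x
    have : (fun s => χ s * ψ x) =ᶠ[𝓝 t] fun _ => ψ x := by
      filter_upwards [hχ t (Ioo_subset_Icc_self ht)] with s hs
      rw [hs, Pi.one_apply, one_mul]
    rw [timeDeriv, this.deriv_eq, deriv_const]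
  have hx : ∀ t, ∀ x ∈ Ω, spaceDeriv (fun z : ℝ × Space d => χ z.1 * ψ z.2) t x = 0 := by
    intro t x hx
    have : (fun y => χ t * ψ y) =ᶠ[𝓝 x] fun _ => χ t := by
      filter_upwards [hψ x hx] with y hy
      rw [hy, Pi.one_apply, mul_one]
    rw [spaceDeriv, this.fderiv_eq, fderiv_const_apply]
  rw [setIntegral_congr_fun (g := fun _ => (0 : ℝ)) measurableSet_Ioo (fun t htt => by
      refine setIntegral_eq_zero_of_forall_eq_zero fun x hxx => ?_
      simp [ht t htt x, hx t x hxx]), integral_zero, sub_eq_zero] at hE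
  have e1 : ∀ (f : Space d → ℝ) t, t ∈ Icc 0 τ →
      ∫ x in Ω, f x * (χ t * ψ x) = ∫ x in Ω, f x := fun f t htt =>
    setIntegral_congr_fun hΩo.measurableSet fun x hxx => by
      simp [hχ1 t htt, hψ1 x hxx]
  dsimp only at hE
  rw [e1 _ τ ⟨hτ.1, le_rfl⟩, e1 _ 0 ⟨le_rfl, hτ.1⟩] at hE
  obtain ⟨-, -, a1, a2⟩ := h.integrable_slice τ hτ
  obtain ⟨-, -, b1, b2⟩ := h.integrable_initial
  rw [integral_toReal a1 (ae_lt_top' a1 a2), integral_toReal b1 (ae_lt_top' b1 b2)] at hE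
  exact (ENNReal.toReal_eq_toReal_iff' a2 b2).mp hE

/-! ### Regularity of the limit on the space-time cylinder -/

section Cylinder

variable {d : ℕ} {T : ℝ} {Ω : Set (Space d)}

lemma cylinderMeasure_eq_prod (T : ℝ) (Ω : Set (Space d)) :
    cylinderMeasure T Ω = (volume.restrict (Ioo 0 T)).prod (volume.restrict Ω) := by
  rw [cylinderMeasure, Measure.prod_restrict, Measure.volume_eq_prod]

lemma IsBitingLimit.memLinftyL1 {f : ℕ → ℝ × Space d → ℝ} {g : ℝ × Space d → ℝ}
    (hΩ : Bornology.IsBounded Ω) (h : IsBitingLimit (cylinderMeasure T Ω) f g) {c : ℝ≥0}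
    (hc : ∀ n, ∀ᵐ τ ∂(volume.restrict (Ioo 0 T)), ∫⁻ x in Ω, ‖f n (τ, x)‖ₑ ≤ c) :
    MemLinftyL1 T Ω (fun t x => g (t, x)) := by
  have : IsFiniteMeasure (volume.restrict Ω) := isFiniteMeasure_restrict.mpr hΩ.measure_lt_top.ne
  refine ⟨h.2.1.1, c, ?_⟩
  rw [cylinderMeasure_eq_prod] at h
  exact h.ae_slice_le hc

/-- The sign test works for scalar limits, so it is applied to each coordinate; summing them costs
only the factor `d`. -/
lemma IsBitingLimit.memLinftyL1_space {f : ℕ → ℝ × Space d → Space d}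
    {g : ℝ × Space d → Space d} (hΩ : Bornology.IsBounded Ω)
    (h : IsBitingLimit (cylinderMeasure T Ω) f g) {c : ℝ≥0}
    (hc : ∀ n, ∀ᵐ τ ∂(volume.restrict (Ioo 0 T)), ∫⁻ x in Ω, ‖f n (τ, x)‖ₑ ≤ c) :
    MemLinftyL1 T Ω (fun t x => g (t, x)) := by
  have : IsFiniteMeasure (volume.restrict Ω) := isFiniteMeasure_restrict.mpr hΩ.measure_lt_top.ne
  have hi : ∀ i : Fin d, ∀ᵐ τ ∂(volume.restrict (Ioo 0 T)), ∫⁻ x in Ω, ‖g (τ, x) i‖ₑ ≤ c := by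
    intro i
    have hp := h.clm_comp (EuclideanSpace.proj i : Space d →L[ℝ] ℝ)
    rw [cylinderMeasure_eq_prod] at hp
    refine hp.ae_slice_le fun n => ?_
    filter_upwards [hc n] with τ hτ
    refine (lintegral_mono fun x => ?_).trans hτ
    simp only [enorm_eq_nnnorm, ENNReal.coe_le_coe]
    exact PiLp.nnnorm_apply_le (f n (τ, x)) i
  have hm : AEStronglyMeasurable g ((volume.restrict (Ioo 0 T)).prod (volume.restrict Ω)) := by
    rw [← cylinderMeasure_eq_prod]
    exact h.2.1.1
  refine ⟨h.2.1.1, d * c, ?_⟩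
  filter_upwards [ae_all_iff.mpr hi, hm.prodMk_left] with τ hτ hτm
  refine (lintegral_mono fun x => EuclideanSpace.enorm_le_sum _).trans ?_
  have hmi : ∀ i ∈ Finset.univ, AEMeasurable (fun x => ‖g (τ, x) i‖ₑ) (volume.restrict Ω) :=
    fun i _ => ((EuclideanSpace.proj i : Space d →L[ℝ] ℝ).continuous.comp_aestronglyMeasurable
      hτm).enorm
  rw [lintegral_finsetSum' _ hmi]
  refine (Finset.sum_le_sum fun i _ => hτ i).trans ?_
  simp

end Cylinder

/-! ### Stable approximations -/

section StableApproximation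

variable {d : ℕ} {γ T : ℝ} {Ω : Set (Space d)} {ρ₀ : Space d → ℝ} {m₀ : Space d → Space d}
  {S₀ : Space d → ℝ} {ρ : ℕ → ℝ → Space d → ℝ} {m : ℕ → ℝ → Space d → Space d}
  {S : ℕ → ℝ → Space d → ℝ}

/-- The states of a stable approximation are bounded in `L^∞(0,T; L^1(Ω))`. -/
lemma IsStableApproximation.exists_bound (hγ : 1 < γ) (hΩ : Bornology.IsBounded Ω)
    (hE₀ : ∫⁻ x in Ω, totalEnergy γ (ρ₀ x) (m₀ x) (S₀ x) ≠ ⊤)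
    (h : IsStableApproximation γ T Ω ρ₀ m₀ S₀ ρ m S) :
    ∃ c : ℝ≥0, ∀ n, ∀ᵐ τ ∂(volume.restrict (Ioo 0 T)),
      (∫⁻ x in Ω, ‖ρ n τ x‖ₑ) + (∫⁻ x in Ω, ‖m n τ x‖ₑ) + (∫⁻ x in Ω, ‖S n τ x‖ₑ) ≤ c := by
  have : IsFiniteMeasure (volume.restrict Ω) := isFiniteMeasure_restrict.mpr hΩ.measure_lt_top.ne
  obtain ⟨M, hM⟩ := h.mass_bound
  obtain ⟨Sinf, hSinf⟩ := h.entropy_bound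
  obtain ⟨e, he, hen⟩ := h.energy_bound
  obtain ⟨b, hb⟩ := he.bddAbove_range
  lift ∫⁻ x in Ω, totalEnergy γ (ρ₀ x) (m₀ x) (S₀ x) to ℝ≥0 using hE₀ with K
  refine ⟨M.toNNReal + ((K + b : ℝ≥0) + M / 2).toNNReal
    + (2 * ((K + b : ℝ≥0) / (γ - 1) + (volume.restrict Ω).real univ) - Sinf).toNNReal,
    fun n => ?_⟩
  have hmm := h.measurable_momentum n
  rw [cylinderMeasure_eq_prod] at hmm
  filter_upwards [hM n, hSinf n, hen n, hmm.prodMk_left] with τ h1 h2 h3 h4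
  refine (lintegral_enorm_le_of_energy hγ h4 h1.1 h1.2 h2.1 h2.2 (K := K + b)
    (h3.trans ?_)).trans_eq ?_
  · rw [ENNReal.coe_add]
    exact add_le_add le_rfl (ENNReal.coe_le_coe.mpr (hb ⟨n, rfl⟩))
  · simp only [ENNReal.ofReal, ENNReal.coe_add]

lemma IsStableApproximation.integrable (hΩ : Bornology.IsBounded Ω)
    (h : IsStableApproximation γ T Ω ρ₀ m₀ S₀ ρ m S) {c : ℝ≥0}
    (hc : ∀ n, ∀ᵐ τ ∂(volume.restrict (Ioo 0 T)),
      (∫⁻ x in Ω, ‖ρ n τ x‖ₑ) + (∫⁻ x in Ω, ‖m n τ x‖ₑ) + (∫⁻ x in Ω, ‖S n τ x‖ₑ) ≤ c) (n : ℕ) :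
    Integrable (fun z : ℝ × Space d => (ρ n z.1 z.2, m n z.1 z.2, S n z.1 z.2))
      (cylinderMeasure T Ω) ∧
    ∫ z, ‖(ρ n z.1 z.2, m n z.1 z.2, S n z.1 z.2)‖ ∂(cylinderMeasure T Ω) ≤
      (c * volume (Ioo 0 T)).toReal := by
  have : IsFiniteMeasure (volume.restrict Ω) := isFiniteMeasure_restrict.mpr hΩ.measure_lt_top.ne
  have hm : AEStronglyMeasurable (fun z : ℝ × Space d => (ρ n z.1 z.2, m n z.1 z.2, S n z.1 z.2))
      (cylinderMeasure T Ω) :=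
    (h.measurable_density n).prodMk ((h.measurable_momentum n).prodMk (h.measurable_entropy n))
  have h1 := h.measurable_density n
  have h2 := h.measurable_momentum n
  rw [cylinderMeasure_eq_prod] at h1 h2
  have hle : ∫⁻ z, ‖(ρ n z.1 z.2, m n z.1 z.2, S n z.1 z.2)‖ₑ ∂(cylinderMeasure T Ω) ≤
      c * volume (Ioo 0 T) := by
    rw [cylinderMeasure_eq_prod] at hm ⊢
    rw [lintegral_prod _ hm.enorm, ← setLIntegral_const]
    refine lintegral_mono_ae ?_
    filter_upwards [hc n, h1.prodMk_left, h2.prodMk_left] with τ hτ h1 h2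
    refine le_trans (lintegral_mono fun x => enorm_triple_le _ _ _) ?_
    have h3 := lintegral_add_left' (h1.enorm.add h2.enorm) fun x => ‖S n τ x‖ₑ
    refine h3.trans_le ?_
    rwa [← lintegral_add_left' h1.enorm] at hτ
  have htop : c * volume (Ioo 0 T) ≠ ⊤ :=
    ENNReal.mul_ne_top ENNReal.coe_ne_top measure_Ioo_lt_top.ne
  refine ⟨⟨hm, hle.trans_lt htop.lt_top⟩, ?_⟩
  rw [integral_norm_eq_lintegral_enorm hm]
  exact ENNReal.toReal_mono htop hle

lemma lintegral_cylinder_energy (hΩ : Bornology.IsBounded Ω) {r : ℝ → Space d → ℝ}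
    {q : ℝ → Space d → Space d} {s : ℝ → Space d → ℝ}
    (hm : AEStronglyMeasurable (fun z : ℝ × Space d => (r z.1 z.2, q z.1 z.2, s z.1 z.2))
      (cylinderMeasure T Ω)) :
    ∫⁻ z, totalEnergy γ (r z.1 z.2) (q z.1 z.2) (s z.1 z.2) ∂(cylinderMeasure T Ω) =
      ∫⁻ τ in Ioo 0 T, ∫⁻ x in Ω, totalEnergy γ (r τ x) (q τ x) (s τ x) := by
  have : IsFiniteMeasure (volume.restrict Ω) := isFiniteMeasure_restrict.mpr hΩ.measure_lt_top.ne
  rw [cylinderMeasure_eq_prod] at hm ⊢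
  exact lintegral_prod _ ((measurable_totalEnergy (γ := γ)).comp_aemeasurable hm.aemeasurable)

/-- If a biting limit of a stable approximation is an admissible weak solution, a subsequence
converges almost everywhere. -/
lemma IsStableApproximation.exists_subseq_tendsto_ae (hγ : 1 < γ) (hΩo : IsOpen Ω)
    (hΩb : Bornology.IsBounded Ω)
    (hE₀ : ∫⁻ x in Ω, totalEnergy γ (ρ₀ x) (m₀ x) (S₀ x) ≠ ⊤)
    (h : IsStableApproximation γ T Ω ρ₀ m₀ S₀ ρ m S) {σ : ℕ → ℕ} (hσ : StrictMono σ)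
    {r' : ℝ → Space d → ℝ} {q' : ℝ → Space d → Space d} {s' : ℝ → Space d → ℝ}
    (hlim : IsBitingLimit (cylinderMeasure T Ω)
      (fun n z => (ρ (σ n) z.1 z.2, m (σ n) z.1 z.2, S (σ n) z.1 z.2))
      (fun z => (r' z.1 z.2, q' z.1 z.2, s' z.1 z.2)))
    {r : ℝ → Space d → ℝ} {q : ℝ → Space d → Space d} {s : ℝ → Space d → ℝ}
    (hrep : ∀ᵐ z ∂(cylinderMeasure T Ω), r z.1 z.2 = r' z.1 z.2 ∧ q z.1 z.2 = q' z.1 z.2 ∧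
      s z.1 z.2 = s' z.1 z.2)
    (hsol : IsAdmissibleWeakSolution γ T Ω ρ₀ m₀ S₀ r q s) :
    ∃ υ : ℕ → ℕ, StrictMono υ ∧ ∀ᵐ z ∂(cylinderMeasure T Ω),
      Tendsto (fun n => ρ (σ (υ n)) z.1 z.2) atTop (𝓝 (r' z.1 z.2)) ∧
      Tendsto (fun n => m (σ (υ n)) z.1 z.2) atTop (𝓝 (q' z.1 z.2)) ∧
      Tendsto (fun n => S (σ (υ n)) z.1 z.2) atTop (𝓝 (s' z.1 z.2)) := by
  have : IsFiniteMeasure (volume.restrict Ω) := isFiniteMeasure_restrict.mpr hΩb.measure_lt_top.ne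
  have : IsFiniteMeasure (cylinderMeasure T Ω) := by
    rw [cylinderMeasure_eq_prod]
    infer_instance
  obtain ⟨e, he, hen⟩ := h.energy_bound
  set K := ∫⁻ x in Ω, totalEnergy γ (ρ₀ x) (m₀ x) (S₀ x) with hK
  have hvol : volume (Ioo 0 T) ≠ ⊤ := measure_Ioo_lt_top.ne
  -- Conservation holds at every time for the representative, and the space-time integral does not
  -- depend on the representative.
  have hEU : ∫⁻ z, totalEnergy γ (r' z.1 z.2) (q' z.1 z.2) (s' z.1 z.2) ∂(cylinderMeasure T Ω)
      = K * volume (Ioo 0 T) := by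
    have h1 : ∫⁻ z, totalEnergy γ (r' z.1 z.2) (q' z.1 z.2) (s' z.1 z.2) ∂(cylinderMeasure T Ω)
        = ∫⁻ z, totalEnergy γ (r z.1 z.2) (q z.1 z.2) (s z.1 z.2) ∂(cylinderMeasure T Ω) := by
      refine lintegral_congr_ae ?_
      filter_upwards [hrep] with z ⟨h1, h2, h3⟩
      rw [h1, h2, h3]
    rw [h1, lintegral_cylinder_energy hΩb (hsol.measurable_density.prodMk
      (hsol.measurable_momentum.prodMk hsol.measurable_entropy)), ← setLIntegral_const]
    exact setLIntegral_congr_fun measurableSet_Ioo fun τ hτ =>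
      hsol.lintegral_energy_eq hΩo hΩb (Ioo_subset_Ico_self hτ)
  have hEn : ∀ n, ∫⁻ z, totalEnergy γ (ρ (σ n) z.1 z.2) (m (σ n) z.1 z.2) (S (σ n) z.1 z.2)
      ∂(cylinderMeasure T Ω) ≤
      ∫⁻ z, totalEnergy γ (r' z.1 z.2) (q' z.1 z.2) (s' z.1 z.2) ∂(cylinderMeasure T Ω)
        + ((e (σ n) * (volume (Ioo 0 T)).toNNReal : ℝ≥0) : ℝ≥0∞) := by
    intro n
    rw [hEU, ENNReal.coe_mul, ENNReal.coe_toNNReal hvol, ← add_mul,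
      lintegral_cylinder_energy hΩb (hlim.1 n).1, ← setLIntegral_const]
    exact lintegral_mono_ae (hen (σ n))
  refine hlim.exists_subseq_tendsto_ae hγ (hEU ▸ ENNReal.mul_ne_top hE₀ hvol) ?_ hEn ?_
  · simpa using (he.comp hσ.tendsto_atTop).mul_const (volume (Ioo 0 T)).toNNReal
  · filter_upwards [hrep, hsol.entropy_vacuum] with z ⟨h1, _, h3⟩ h4
    rwa [h1, h3] at h4

end StableApproximation

/-! ### The main theorem -/

theorem theorem2p1 {d : ℕ} (hd : 1 ≤ d) {γ : ℝ} (hγ : 1 < γ) {T : ℝ} (hT : 0 < T)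
    {Ω : Set (Space d)} (hΩ : IsBoundedLipschitzDomain Ω)
    {ρ₀ : Space d → ℝ} {m₀ : Space d → Space d} {S₀ : Space d → ℝ}
    (hρ₀_meas : AEStronglyMeasurable ρ₀ (volume.restrict Ω))
    (hm₀_meas : AEStronglyMeasurable m₀ (volume.restrict Ω))
    (hS₀_meas : AEStronglyMeasurable S₀ (volume.restrict Ω))
    (hρ₀ : ∀ᵐ x ∂(volume.restrict Ω), 0 < ρ₀ x)
    {sinf : ℝ} (hS₀ : ∀ᵐ x ∂(volume.restrict Ω), ρ₀ x * sinf ≤ S₀ x)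
    (hE₀ : ∫⁻ x in Ω, totalEnergy γ (ρ₀ x) (m₀ x) (S₀ x) ≠ ⊤)
    {ρ : ℕ → ℝ → Space d → ℝ} {m : ℕ → ℝ → Space d → Space d} {S : ℕ → ℝ → Space d → ℝ}
    (hstable : IsStableApproximation γ T Ω ρ₀ m₀ S₀ ρ m S) :
    (∃ c : ℝ≥0, ∀ n, ∀ᵐ τ ∂(volume.restrict (Ioo 0 T)),
      (∫⁻ x in Ω, ‖ρ n τ x‖ₑ) + (∫⁻ x in Ω, ‖m n τ x‖ₑ) + (∫⁻ x in Ω, ‖S n τ x‖ₑ) ≤ c) ∧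
    ∃ σ : ℕ → ℕ, StrictMono σ ∧
      ∃ (ρlim : ℝ → Space d → ℝ) (mlim : ℝ → Space d → Space d) (Slim : ℝ → Space d → ℝ),
        IsBitingLimit (cylinderMeasure T Ω)
          (fun n z => (ρ (σ n) z.1 z.2, m (σ n) z.1 z.2, S (σ n) z.1 z.2))
          (fun z => (ρlim z.1 z.2, mlim z.1 z.2, Slim z.1 z.2)) ∧
        MemLinftyL1 T Ω ρlim ∧ MemLinftyL1 T Ω mlim ∧ MemLinftyL1 T Ω Slim ∧
        -- The limit is an a.e. equivalence class; being an admissible weak solution, whose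
        -- identities are imposed at every time, refers to some representative of it.
        ((∃ (r : ℝ → Space d → ℝ) (q : ℝ → Space d → Space d) (s : ℝ → Space d → ℝ),
            (∀ᵐ z ∂(cylinderMeasure T Ω), r z.1 z.2 = ρlim z.1 z.2 ∧
              q z.1 z.2 = mlim z.1 z.2 ∧ s z.1 z.2 = Slim z.1 z.2) ∧
            IsAdmissibleWeakSolution γ T Ω ρ₀ m₀ S₀ r q s) →
          ∀ᵐ z ∂(cylinderMeasure T Ω),
            Tendsto (fun n => ρ (σ n) z.1 z.2) atTop (𝓝 (ρlim z.1 z.2)) ∧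
            Tendsto (fun n => m (σ n) z.1 z.2) atTop (𝓝 (mlim z.1 z.2)) ∧
            Tendsto (fun n => S (σ n) z.1 z.2) atTop (𝓝 (Slim z.1 z.2))) := by
  obtain ⟨c, hc⟩ := hstable.exists_bound hγ hΩ.isBounded hE₀
  refine ⟨⟨c, hc⟩, ?_⟩
  have : IsFiniteMeasure (volume.restrict Ω) :=
    isFiniteMeasure_restrict.mpr hΩ.isBounded.measure_lt_top.ne
  have : IsFiniteMeasure (cylinderMeasure T Ω) := by
    rw [cylinderMeasure_eq_prod]
    infer_instance
  have hint := hstable.integrable hΩ.isBounded hc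
  obtain ⟨σ, hσ, G, hG⟩ := exists_subseq_isBitingLimit (μ := cylinderMeasure T Ω)
    (fun n z => (ρ n z.1 z.2, m n z.1 z.2, S n z.1 z.2)) (fun n => (hint n).1)
    (fun n => (hint n).2)
  have hρG : MemLinftyL1 T Ω fun t x => (G (t, x)).1 :=
    (hG.clm_comp (ContinuousLinearMap.fst ℝ ℝ (Space d × ℝ))).memLinftyL1 hΩ.isBounded
      fun n => (hc (σ n)).mono fun τ hτ => (le_self_add.trans le_self_add).trans hτ
  have hmG : MemLinftyL1 T Ω fun t x => (G (t, x)).2.1 :=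
    (hG.clm_comp ((ContinuousLinearMap.fst ℝ (Space d) ℝ).comp
      (ContinuousLinearMap.snd ℝ ℝ (Space d × ℝ)))).memLinftyL1_space hΩ.isBounded
      fun n => (hc (σ n)).mono fun τ hτ => (le_add_self.trans le_self_add).trans hτ
  have hSG : MemLinftyL1 T Ω fun t x => (G (t, x)).2.2 :=
    (hG.clm_comp ((ContinuousLinearMap.snd ℝ (Space d) ℝ).comp
      (ContinuousLinearMap.snd ℝ ℝ (Space d × ℝ)))).memLinftyL1 hΩ.isBounded
      fun n => (hc (σ n)).mono fun τ hτ => le_add_self.trans hτ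
  -- The subsequence must be fixed before the implication is stated. A further extraction is made
  -- only if the limit is a solution; it leaves the biting limit unchanged.
  by_cases hsol : ∃ (r : ℝ → Space d → ℝ) (q : ℝ → Space d → Space d) (s : ℝ → Space d → ℝ),
      (∀ᵐ z ∂(cylinderMeasure T Ω), r z.1 z.2 = (G (z.1, z.2)).1 ∧
        q z.1 z.2 = (G (z.1, z.2)).2.1 ∧ s z.1 z.2 = (G (z.1, z.2)).2.2) ∧
      IsAdmissibleWeakSolution γ T Ω ρ₀ m₀ S₀ r q s
  · obtain ⟨r, q, s, hrep, hs⟩ := hsol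
    obtain ⟨υ, hυ, hconv⟩ := hstable.exists_subseq_tendsto_ae hγ hΩ.isOpen hΩ.isBounded hE₀ hσ
      (r' := fun t x => (G (t, x)).1) (q' := fun t x => (G (t, x)).2.1)
      (s' := fun t x => (G (t, x)).2.2) hG hrep hs
    exact ⟨fun n => σ (υ n), hσ.comp hυ, fun t x => (G (t, x)).1, fun t x => (G (t, x)).2.1,
      fun t x => (G (t, x)).2.2, hG.comp_strictMono hυ, hρG, hmG, hSG, fun _ => hconv⟩
  · exact ⟨σ, hσ, fun t x => (G (t, x)).1, fun t x => (G (t, x)).2.1,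
      fun t x => (G (t, x)).2.2, hG, hρG, hmG, hSG, fun h => absurd h hsol⟩
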